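/- Consider the scalar plant $x_{k+1}=ax_k+bu_k+w_k$, $k\ge 0$, with $a\in\mathbb R$, $b\neq 0$, where $(w_k)$ is i.i.d. with law $\mathcal N(0,\sigma_w^2)$, $\sigma_w>0$, and $x_0\sim\mathcal N(0,\sigma_0^2)$. Let $\epsilon>0$, let $T\in\mathbb N_0$ be the time-out, and let $K=-a/b$ be the dead-beat gain. The channel is lossless. Let $r_k$ be the number of steps since the latest transmission. The input is $u_k=Kx_k$ if $r_k=0$ (a control packet is transmitted) and $u_k=0$ otherwise; $r_{k+1}=0$ if $|x_{k+1}|>\epsilon$ or $r_k\ge T$ (that is, the number $r_k+1$ of steps since the latest transmission exceeds $T$), and $r_{k+1}=r_k+1$ otherwise. The counter starts at $r_0\in\{0,1\}$, and $(x_0,r_0)$ is independent of $(w_k)$. For $i\ge 0$ put $\xi_i=\sum_{j=0}^{i}a^jw_{i-j}$ and $\mathcal F_i=\bigcap_{j=0}^{i-1}\{|\xi_j|\le\epsilon\}$ ($\mathcal F_0$ is the sure event), and \[p_{i0}=1-\frac{\mathbf P(\mathcal F_{i+1})}{\mathbf P(\mathcal F_i)}\ (0\le i<T),\qquad p_{T0}=1,\qquad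 p_{i,i+1}=1-p_{i0}\ (0\le i<T),\] all other $p_{ij}$, $0\le i,j\le T$, being $0$. Then $(p_{ij})$ gives the transition probabilities of $r_k$: for all $k>T$ and $0\le i,j\le T$, $\mathbf P(r_k=i)>0$ and $\mathbf P(r_{k+1}=j\mid r_k=i)=p_{ij}$. The matrix $(p_{ij})$ has a unique invariant probability distribution $\pi$ on $\{0,\dots,T\}$, and $\pi_i>0$ for all $i$. For all $Q_x\ge 0$, $Q_u>0$ and $\rho\in\mathbb R$, with $\widetilde Q=Q_x+\rho K Q_uK$, the long-run average cost \[J_\infty=\lim_{N\to\infty}\frac1N\sum_{k=0}^{N-1}\bigl(Q_xx_k^2+\rho\, Q_uu_k^2\bigr)\] exists almost surely and is almost surely equal to the constant \[\Bigl[p_{00}\widetilde Q\,\Sigma_0^c+\sum_{i=1}^{T}\bigl(Q_x\Sigma_{i-1}+p_{i0}\widetilde Q\,\Sigma_i^c\bigr)\prod_{j=0}^{i-1}(1-p_{j0})\Bigr]\pi_0,\] where $\Sigma_i=\mathbf{Var}[\xi_i\mid\mathcal F_{i+1}]$ and $\Sigma_i^c=\mathbf{Var}[\xi_i\mid|\xi_i|>\epsilon,\mathcal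 F_i]$ for $0\le i\le T-1$, and $\Sigma_T^c=a^2\,\mathbf{Var}[\xi_{T-1}\mid\mathcal F_T]+\sigma_w^2$ (with $\xi_{-1}=0$, so $\Sigma_0^c=\sigma_w^2$ when $T=0$). -/

import Mathlib

open MeasureTheory ProbabilityTheory Filter Topology
open scoped NNReal Matrix

namespace EventTriggered

/-- The scalar event-triggered closed loop over a lossless channel, on a probability space `(Ω, P)`.

* plant: `x_{k+1} = a x_k + b u_k + w_k`, with `w` a Gaussian white noise of variance `σw ^ 2`,
  `x_0 ∼ N(0, σ0 ^ 2)` and the initial data independent of the noise;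
* input: `u_k = K x_k` when a control packet is transmitted (`r_k = 0`), and `u_k = 0` otherwise;
* `r_k`: the number of steps since the latest transmission.  A transmission takes place at time
  `k + 1` when the threshold is crossed, `|x_{k+1}| > ε`, or when the number `r_k + 1` of steps
  since the latest transmission exceeds the time-out `T`, that is `T ≤ r_k`.  The counter starts at
  `r_0 ∈ {0, 1}`, which may depend on `x_0`. -/
structure ClosedLoop {Ω : Type*} [MeasurableSpace Ω] (P : Measure Ω)
    (a b K ε : ℝ) (T : ℕ) (σw σ0 : ℝ≥0) (x u w : ℕ → Ω → ℝ) (r : ℕ → Ω → ℕ) : Prop where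
  measurable_noise : ∀ k, Measurable (w k)
  measurable_init : Measurable (x 0)
  measurable_counter_init : Measurable (r 0)
  law_noise : ∀ k, P.map (w k) = gaussianReal 0 (σw ^ 2)
  law_init : P.map (x 0) = gaussianReal 0 (σ0 ^ 2)
  indep_noise : iIndepFun w P
  indep_init : IndepFun (fun ω => (x 0 ω, r 0 ω)) (fun ω k => w k ω) P
  counter_init : ∀ ω, r 0 ω = 0 ∨ r 0 ω = 1
  state : ∀ k ω, x (k + 1) ω = a * x k ω + b * u k ω + w k ω
  input : ∀ k ω, u k ω = if r k ω = 0 then K * x k ω else 0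
  counter : ∀ k ω, r (k + 1) ω = if ε < |x (k + 1) ω| ∨ T ≤ r k ω then 0 else r k ω + 1

section Truncated

variable {Ω : Type*} [MeasurableSpace Ω]

/-- `ξ_i = ∑_{j=0}^{i} a^j w_{i-j}`: the state of the plant `i + 1` steps after a reset
(so that `ξ_{i+1} = a ξ_i + w_{i+1}`, and `(ξ_0, …, ξ_i)` is a centred Gaussian vector with
`E[ξ_m ξ_n] = ∑_{j=0}^{m} a^{2j+n-m} σw²` for `m ≤ n`). -/
noncomputable def xi (a : ℝ) (w : ℕ → Ω → ℝ) (i : ℕ) (ω : Ω) : ℝ :=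
  ∑ j ∈ Finset.range (i + 1), a ^ j * w (i - j) ω

/-- The event `F_i = ⋂_{j < i} {|ξ_j| ≤ ε}`; `F_0` is the sure event. -/
def eventF (a ε : ℝ) (w : ℕ → Ω → ℝ) (i : ℕ) : Set Ω :=
  {ω | ∀ j < i, |xi a w j ω| ≤ ε}

/-- `p_{i0}`: it is `1 - P(F_{i+1}) / P(F_i)` for `i < T`, and `1` for `i = T`. -/
noncomputable def resetProb (P : Measure Ω) (a ε : ℝ) (T : ℕ) (w : ℕ → Ω → ℝ) (i : ℕ) : ℝ :=
  if i < T then 1 - P.real (eventF a ε w (i + 1)) / P.real (eventF a ε w i) else 1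

/-- The transition matrix `(p_{ij})` on the states `0, …, T`: from `i`, the counter goes to `0`
with probability `p_{i0}` and to `i + 1` with probability `1 - p_{i0}`. -/
noncomputable def transMatrix (P : Measure Ω) (a ε : ℝ) (T : ℕ) (w : ℕ → Ω → ℝ) :
    Matrix (Fin (T + 1)) (Fin (T + 1)) ℝ :=
  fun i j =>
    if (j : ℕ) = 0 then resetProb P a ε T w i
    else if (j : ℕ) = (i : ℕ) + 1 then 1 - resetProb P a ε T w i
    else 0

/-- `Σ_i = Var[ξ_i | F_{i+1}]`. -/
noncomputable def truncVar (P : Measure Ω) (a ε : ℝ) (w : ℕ → Ω → ℝ) (i : ℕ) : ℝ :=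
  variance (xi a w i) (cond P (eventF a ε w (i + 1)))

/-- `Σ_i^c = Var[ξ_i | |ξ_i| > ε, F_i]` for `i < T`, and `Σ_T^c = a² Var[ξ_{T-1} | F_T] + σw²`,
where the (empty) sum `ξ_{-1}` is `0`. -/
noncomputable def truncVarC (P : Measure Ω) (a ε : ℝ) (T : ℕ) (σw : ℝ≥0) (w : ℕ → Ω → ℝ)
    (i : ℕ) : ℝ :=
  if i < T then variance (xi a w i) (cond P ({ω | ε < |xi a w i ω|} ∩ eventF a ε w i))
  else a ^ 2 * (if T = 0 then 0 else truncVar P a ε w (T - 1)) + (σw : ℝ) ^ 2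

end Truncated

end EventTriggered

open scoped ENNReal

/-! With the dead-beat gain, a transmission at time m erases the state: x_{m+1} = w_m, and until the
next transmission x_{m+i+1} is ξ_i evaluated on the noise from time m on. Hence for i ≤ T the event
{r_{m+i} = i} is {r_m = 0} intersected with the event that this noise lies in F_i
(`counter_add_iff`). The two are independent, since r_m depends only on the initial data and the
noise before m. With q_i = P(F_i) this gives P(r_{m+i} = i) = P(r_m = 0) q_i, hence the transition
probabilities; the balance equations then force π_i = q_i / ∑ q_j (`invariant_iff_eq_survival`).

The average cost needs neither an ergodic nor a renewal theorem. For k > T the cost at time k + 1 is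
a sum over i ≤ T of terms 1{r_{k-i} = 0} H_i(noise from k - i on), with H_i cut off to F_i
(`sum_reset_indicator`). As H_i depends on finitely many noise variables, the terms 1{r_m = 0}(H_i -
E H_i) are orthogonal at large enough time distance, and their averages vanish by
`strong_law_of_orthogonal`. The choice H_i = 1_{F_i}, for which the sum is 1, gives the transmission
frequency 1 / ∑ q_j = π_0; the average cost is then π_0 ∑ E H_i. By symmetry of the noise the
conditional means are zero, so second moments are variances, and a re-indexing gives the stated
bracket (`sum_setIntegral_stageCost`). -/

namespace EventTriggered

/-! ### Strong law of large numbers from orthogonality at a distance -/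

section StrongLaw

variable {Ω : Type*} [MeasurableSpace Ω] {P : Measure Ω}

/-- The expectation of the series is finite, so the series converges almost surely and its terms
tend to zero. -/
lemma ae_tendsto_zero_of_summable_integral {f : ℕ → Ω → ℝ} (hf : ∀ n ω, 0 ≤ f n ω)
    (hint : ∀ n, Integrable (f n) P) (hs : Summable fun n => ∫ ω, f n ω ∂P) :
    ∀ᵐ ω ∂P, Tendsto (fun n => f n ω) atTop (𝓝 0) := by
  have h1 : ∫⁻ ω, ∑' n, ENNReal.ofReal (f n ω) ∂P ≠ ⊤ := by
    rw [lintegral_tsum fun n => (hint n).1.aemeasurable.ennreal_ofReal]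
    have : ∀ n, ∫⁻ ω, ENNReal.ofReal (f n ω) ∂P = ENNReal.ofReal (∫ ω, f n ω ∂P) := fun n =>
      (ofReal_integral_eq_lintegral_ofReal (hint n) (ae_of_all _ (hf n))).symm
    simp_rw [this]
    exact hs.tsum_ofReal_ne_top
  filter_upwards [ae_lt_top' (AEMeasurable.tsum
    fun n => (hint n).1.aemeasurable.ennreal_ofReal) h1] with ω hω
  have := ENNReal.tendsto_atTop_zero_of_tsum_ne_top hω.ne
  refine ((ENNReal.tendsto_toReal ENNReal.zero_ne_top).comp this).congr fun n => ?_
  exact ENNReal.toReal_ofReal (hf n ω)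

/-- After expansion of the square only a band around the diagonal can contribute positively, and
each entry is at most C because 2xy ≤ x² + y². -/
lemma integral_sq_sum_le {D : ℕ → Ω → ℝ} {C : ℝ} {d : ℕ} (hD : ∀ m, MemLp (D m) 2 P)
    (hC : ∀ m, ∫ ω, D m ω ^ 2 ∂P ≤ C)
    (horth : ∀ m n, m + d ≤ n → ∫ ω, D m ω * D n ω ∂P = 0) (A n : ℕ) :
    ∫ ω, (∑ k ∈ Finset.range n, D (A + k) ω) ^ 2 ∂P ≤ n * (2 * d * C) := by
  have hint : ∀ j k, Integrable (fun ω => D j ω * D k ω) P := fun j k =>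
    (hD j).integrable_mul (hD k)
  have hC0 : 0 ≤ C := (integral_nonneg fun ω => sq_nonneg _).trans (hC 0)
  have hle : ∀ j k, ∫ ω, D j ω * D k ω ∂P ≤ C := by
    intro j k
    have h2 : ∫ ω, D j ω * D k ω ∂P ≤ ∫ ω, (D j ω ^ 2 + D k ω ^ 2) / 2 ∂P := by
      refine integral_mono (hint j k)
        (((hD j).integrable_sq.add (hD k).integrable_sq).div_const 2) fun ω => ?_
      have := sq_nonneg (D j ω - D k ω)
      simp only
      nlinarith
    rw [integral_div, integral_add (hD j).integrable_sq (hD k).integrable_sq] at h2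
    linarith [hC j, hC k]
  have hsq : ∀ ω, (∑ k ∈ Finset.range n, D (A + k) ω) ^ 2 =
      ∑ j ∈ Finset.range n, ∑ k ∈ Finset.range n, D (A + j) ω * D (A + k) ω := fun ω => by
    rw [sq, Finset.sum_mul_sum]
  simp_rw [hsq]
  rw [integral_finsetSum _ fun j _ => integrable_finsetSum _ fun k _ => hint _ _]
  simp_rw [integral_finsetSum _ fun k _ => hint _ _]
  -- The band around j has at most 2d indices, also when the subtraction j + 1 - d is truncated.
  have hrow : ∀ j ∈ Finset.range n,
      ∑ k ∈ Finset.range n, ∫ ω, D (A + j) ω * D (A + k) ω ∂P ≤ 2 * d * C := by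
    intro j _
    calc ∑ k ∈ Finset.range n, ∫ ω, D (A + j) ω * D (A + k) ω ∂P
        ≤ ∑ k ∈ Finset.range n, if k ∈ Finset.Ico (j + 1 - d) (j + d) then C else 0 := by
          refine Finset.sum_le_sum fun k _ => ?_
          split_ifs with h
          · exact hle _ _
          · rw [Finset.mem_Ico, not_and_or, not_le, not_lt] at h
            rcases h with h | h
            · simp_rw [mul_comm (D (A + j) _)]
              exact (horth _ _ (by omega)).le
            · exact (horth _ _ (by omega)).le
      _ = ((Finset.range n).filter (· ∈ Finset.Ico (j + 1 - d) (j + d))).card * C := by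
          rw [← Finset.sum_filter, Finset.sum_const, nsmul_eq_mul]
      _ ≤ 2 * d * C := by
          refine mul_le_mul_of_nonneg_right ?_ hC0
          have : ((Finset.range n).filter (· ∈ Finset.Ico (j + 1 - d) (j + d))).card ≤ 2 * d := by
            refine (Finset.card_le_card (t := Finset.Ico (j + 1 - d) (j + d)) ?_).trans ?_
            · exact fun k hk => (Finset.mem_filter.1 hk).2
            · rw [Nat.card_Ico]; omega
          exact_mod_cast this
  calc _ ≤ ∑ j ∈ Finset.range n, 2 * d * C := Finset.sum_le_sum hrow
    _ = n * (2 * d * C) := by simp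

/-- Strong law of large numbers for square-integrable variables with bounded second moments that
are orthogonal at distance at least `d`. -/
theorem strong_law_of_orthogonal {D : ℕ → Ω → ℝ} {C : ℝ} {d : ℕ} (hD : ∀ m, MemLp (D m) 2 P)
    (hC : ∀ m, ∫ ω, D m ω ^ 2 ∂P ≤ C)
    (horth : ∀ m n, m + d ≤ n → ∫ ω, D m ω * D n ω ∂P = 0) :
    ∀ᵐ ω ∂P, Tendsto (fun N : ℕ => (1 / (N : ℝ)) * ∑ k ∈ Finset.range N, D k ω) atTop (𝓝 0) := by
  have hC0 : 0 ≤ C := (integral_nonneg fun ω => sq_nonneg _).trans (hC 0)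
  set M : ℝ := 2 * d * C with hM
  have hM0 : 0 ≤ M := by positivity
  have hL2 : ∀ A n, Integrable (fun ω => (∑ k ∈ Finset.range n, D (A + k) ω) ^ 2) P := fun A n =>
    (memLp_finsetSum _ fun k _ => hD (A + k)).integrable_sq
  -- `f n` is the squared average at the square time n². `g n` sums the squares of all blocks
  -- starting at n² of length j ≤ 2n, hence dominates each of them up to the next square. Both have
  -- expectation O(1/n²); at n = 0 both are 0 by division by zero.
  set f : ℕ → Ω → ℝ := fun n ω => (∑ k ∈ Finset.range (n ^ 2), D (0 + k) ω) ^ 2 / (n : ℝ) ^ 4 with hf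
  set g : ℕ → Ω → ℝ := fun n ω => ∑ j ∈ Finset.range (2 * n + 1),
    (∑ k ∈ Finset.range j, D (n ^ 2 + k) ω) ^ 2 / (n : ℝ) ^ 4 with hg
  have hf0 : ∀ n ω, 0 ≤ f n ω := fun n ω => by positivity
  have hg0 : ∀ n ω, 0 ≤ g n ω := fun n ω => Finset.sum_nonneg fun j _ => by positivity
  have hfi : ∀ n, Integrable (f n) P := fun n => (hL2 _ _).div_const _
  have hgi : ∀ n, Integrable (g n) P := fun n =>
    integrable_finsetSum _ fun j _ => (hL2 _ _).div_const _
  have hsum : Summable fun n : ℕ => 1 / (n : ℝ) ^ 2 := Real.summable_one_div_nat_pow.2 (by norm_num)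
  have hfs : Summable fun n => ∫ ω, f n ω ∂P := by
    refine Summable.of_nonneg_of_le (fun n => integral_nonneg (hf0 n)) (fun n => ?_)
      (hsum.mul_left M)
    simp only [hf]
    rw [integral_div]
    rcases Nat.eq_zero_or_pos n with rfl | hn
    · simp
    have hn' : (0 : ℝ) < n := by exact_mod_cast hn
    rw [div_le_iff₀ (by positivity)]
    refine (integral_sq_sum_le hD hC horth 0 (n ^ 2)).trans (le_of_eq ?_)
    push_cast
    field_simp
    ring
  have hgs : Summable fun n => ∫ ω, g n ω ∂P := by
    refine Summable.of_nonneg_of_le (fun n => integral_nonneg (hg0 n)) (fun n => ?_)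
      (hsum.mul_left (6 * M))
    simp only [hg]
    rw [integral_finsetSum _ fun j _ => (hL2 _ _).div_const _]
    rcases Nat.eq_zero_or_pos n with rfl | hn
    · simp
    have hn' : (1 : ℝ) ≤ n := by exact_mod_cast hn
    calc ∑ j ∈ Finset.range (2 * n + 1),
          ∫ ω, (∑ k ∈ Finset.range j, D (n ^ 2 + k) ω) ^ 2 / (n : ℝ) ^ 4 ∂P
        ≤ ∑ j ∈ Finset.range (2 * n + 1), (2 * n * M) / (n : ℝ) ^ 4 := by
          refine Finset.sum_le_sum fun j hj => ?_
          rw [integral_div]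
          refine div_le_div_of_nonneg_right ?_ (by positivity)
          refine (integral_sq_sum_le hD hC horth _ j).trans ?_
          refine mul_le_mul_of_nonneg_right ?_ hM0
          have := Finset.mem_range.1 hj
          exact_mod_cast (by omega : j ≤ 2 * n)
      _ = (2 * n + 1) * ((2 * n * M) / (n : ℝ) ^ 4) := by simp
      _ ≤ (3 * n) * ((2 * n * M) / (n : ℝ) ^ 4) := by
          refine mul_le_mul_of_nonneg_right (by linarith) (by positivity)
      _ = 6 * M * (1 / (n : ℝ) ^ 2) := by field_simp; ring
  filter_upwards [ae_tendsto_zero_of_summable_integral hf0 hfi hfs,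
    ae_tendsto_zero_of_summable_integral hg0 hgi hgs] with ω hfω hgω
  have hsqrt : Tendsto Nat.sqrt atTop atTop :=
    tendsto_atTop_atTop.2 fun b => ⟨b ^ 2, fun N hN => by
      rw [Nat.le_sqrt, ← sq]; exact hN⟩
  have hlim : Tendsto (fun N : ℕ => √(f N.sqrt ω) + √(g N.sqrt ω)) atTop (𝓝 0) := by
    have := ((Real.continuous_sqrt.tendsto 0).comp (hfω.comp hsqrt)).add
      ((Real.continuous_sqrt.tendsto 0).comp (hgω.comp hsqrt))
    simpa using this
  refine squeeze_zero_norm' ?_ hlim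
  filter_upwards [eventually_ge_atTop 1] with N hN
  obtain ⟨n, hn⟩ : ∃ n, n = N.sqrt := ⟨_, rfl⟩
  rw [← hn]
  have hn1 : 1 ≤ n := by rw [hn, Nat.le_sqrt]; simpa using hN
  have hnN : n ^ 2 ≤ N := hn ▸ Nat.sqrt_le' N
  have hNn : N < (n + 1) ^ 2 := hn ▸ Nat.lt_succ_sqrt' N
  obtain ⟨j, rfl⟩ : ∃ j, N = n ^ 2 + j := ⟨N - n ^ 2, by omega⟩
  clear hn
  have hj : j < 2 * n + 1 := by nlinarith
  have hn' : (0 : ℝ) < (n : ℝ) ^ 2 := by positivity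
  have h4 : (n : ℝ) ^ 4 = ((n : ℝ) ^ 2) ^ 2 := by ring
  have e1 : √(f n ω) = |∑ k ∈ Finset.range (n ^ 2), D (0 + k) ω| / (n : ℝ) ^ 2 := by
    simp only [hf]
    rw [h4, ← div_pow, Real.sqrt_sq_eq_abs, abs_div, abs_of_pos hn']
  have e2 : |∑ k ∈ Finset.range j, D (n ^ 2 + k) ω| / (n : ℝ) ^ 2 ≤ √(g n ω) := by
    refine Real.le_sqrt_of_sq_le ?_
    rw [div_pow, sq_abs, ← h4]
    exact Finset.single_le_sum
      (f := fun j => (∑ k ∈ Finset.range j, D (n ^ 2 + k) ω) ^ 2 / (n : ℝ) ^ 4)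
      (fun i _ => by positivity) (Finset.mem_range.2 hj)
  rw [Finset.sum_range_add, norm_mul, Real.norm_eq_abs, Real.norm_eq_abs]
  have hcast : |1 / ((n ^ 2 + j : ℕ) : ℝ)| ≤ 1 / (n : ℝ) ^ 2 := by
    rw [abs_of_nonneg (by positivity)]
    refine one_div_le_one_div_of_le hn' ?_
    push_cast
    linarith [(Nat.cast_nonneg j : (0 : ℝ) ≤ j)]
  calc _ ≤ 1 / (n : ℝ) ^ 2 * (|∑ k ∈ Finset.range (n ^ 2), D k ω| +
        |∑ k ∈ Finset.range j, D (n ^ 2 + k) ω|) :=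
        mul_le_mul hcast (abs_add_le _ _) (abs_nonneg _) (by positivity)
    _ = |∑ k ∈ Finset.range (n ^ 2), D (0 + k) ω| / (n : ℝ) ^ 2 +
        |∑ k ∈ Finset.range j, D (n ^ 2 + k) ω| / (n : ℝ) ^ 2 := by simp only [zero_add]; ring
    _ ≤ _ := by rw [e1]; gcongr

end StrongLaw

/-! ### Cesàro means and time shifts -/

section Cesaro

/-- The Cesàro means of `f` converge to `L`. -/
def HasAverage (f : ℕ → ℝ) (L : ℝ) : Prop :=
  Tendsto (fun N : ℕ => (1 / (N : ℝ)) * ∑ k ∈ Finset.range N, f k) atTop (𝓝 L)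

lemma HasAverage.congr {f g : ℕ → ℝ} {L : ℝ} (h : HasAverage f L) (hfg : ∀ n, f n = g n) :
    HasAverage g L :=
  funext hfg ▸ h

lemma HasAverage.add {f g : ℕ → ℝ} {L M : ℝ} (hf : HasAverage f L) (hg : HasAverage g M) :
    HasAverage (fun n => f n + g n) (L + M) :=
  (Tendsto.add hf hg).congr fun N => by rw [← mul_add, Finset.sum_add_distrib]

lemma HasAverage.const_mul {f : ℕ → ℝ} {L : ℝ} (c : ℝ) (hf : HasAverage f L) :
    HasAverage (fun n => c * f n) (c * L) :=
  (Tendsto.const_mul c hf).congr fun N => by rw [← Finset.mul_sum]; ring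

lemma HasAverage.sum {ι : Type*} {s : Finset ι} {f : ι → ℕ → ℝ} {L : ι → ℝ}
    (h : ∀ i ∈ s, HasAverage (f i) (L i)) :
    HasAverage (fun n => ∑ i ∈ s, f i n) (∑ i ∈ s, L i) :=
  (tendsto_finsetSum s h).congr fun N => by rw [Finset.sum_comm, Finset.mul_sum]

lemma hasAverage_const (c : ℝ) : HasAverage (fun _ => c) c := by
  refine tendsto_const_nhds.congr' ?_
  filter_upwards [eventually_ge_atTop 1] with N hN
  have : (0 : ℝ) < N := by exact_mod_cast hN
  simp only [Finset.sum_const, Finset.card_range, nsmul_eq_mul]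
  field_simp

lemma hasAverage_succ_iff {f : ℕ → ℝ} {L : ℝ} :
    HasAverage (fun n => f (n + 1)) L ↔ HasAverage f L := by
  have hinv : Tendsto (fun N : ℕ => 1 / (N : ℝ)) atTop (𝓝 0) := tendsto_one_div_atTop_nhds_zero_nat
  unfold HasAverage
  rw [← tendsto_add_atTop_iff_nat
    (f := fun N : ℕ => (1 / (N : ℝ)) * ∑ k ∈ Finset.range N, f k) 1]
  constructor <;> intro h
  · have h1 : Tendsto (fun N : ℕ => (1 - 1 / ((N : ℝ) + 1)) *
        ((1 / (N : ℝ)) * ∑ k ∈ Finset.range N, f (k + 1)) + 1 / ((N : ℝ) + 1) * f 0) atTop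
        (𝓝 ((1 - 0) * L + 0 * f 0)) :=
      ((tendsto_const_nhds.sub tendsto_one_div_add_atTop_nhds_zero_nat).mul h).add
        (tendsto_one_div_add_atTop_nhds_zero_nat.mul_const _)
    rw [sub_zero, one_mul, zero_mul, add_zero] at h1
    refine h1.congr' ?_
    filter_upwards [eventually_ge_atTop 1] with N hN
    have : (0 : ℝ) < N := by exact_mod_cast hN
    rw [Finset.sum_range_succ']
    push_cast
    field_simp
    ring
  · have h1 : Tendsto (fun N : ℕ => (1 + 1 / (N : ℝ)) *
        ((1 / ((N + 1 : ℕ) : ℝ)) * ∑ k ∈ Finset.range (N + 1), f k) - 1 / (N : ℝ) * f 0) atTop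
        (𝓝 ((1 + 0) * L - 0 * f 0)) :=
      ((tendsto_const_nhds.add hinv).mul h).sub (hinv.mul_const _)
    rw [add_zero, one_mul, zero_mul, sub_zero] at h1
    refine h1.congr' ?_
    filter_upwards [eventually_ge_atTop 1] with N hN
    have : (0 : ℝ) < N := by exact_mod_cast hN
    rw [Finset.sum_range_succ']
    push_cast
    field_simp
    ring

lemma hasAverage_add_iff {f : ℕ → ℝ} {L : ℝ} (d : ℕ) :
    HasAverage (fun n => f (n + d)) L ↔ HasAverage f L := by
  induction d with
  | zero => rfl
  | succ d ih =>
    rw [← ih, ← hasAverage_succ_iff (f := fun k => f (k + d))]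
    simp only [add_right_comm, add_assoc]

/-- For a shift by one the sum telescopes to two boundary terms, bounded by 2C. -/
lemma hasAverage_sub_shift {f : ℕ → ℝ} {C : ℝ} (hf : ∀ n, |f n| ≤ C) (d : ℕ) :
    HasAverage (fun n => f (n + d) - f n) 0 := by
  have hinv : Tendsto (fun N : ℕ => 1 / (N : ℝ)) atTop (𝓝 0) := tendsto_one_div_atTop_nhds_zero_nat
  induction d with
  | zero => simpa using hasAverage_const 0
  | succ d ih =>
    have h1 : HasAverage (fun n => f (n + d + 1) - f (n + d)) 0 := by
      have hlim : Tendsto (fun N : ℕ => 1 / (N : ℝ) * (2 * C)) atTop (𝓝 0) := by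
        simpa using hinv.mul_const (2 * C)
      refine squeeze_zero_norm (fun N => ?_) hlim
      rw [show ∑ k ∈ Finset.range N, (f (k + d + 1) - f (k + d)) = f (N + d) - f (0 + d) by
          simpa only [add_right_comm] using Finset.sum_range_sub (fun k => f (k + d)) N, norm_mul, Real.norm_eq_abs, Real.norm_eq_abs,
        abs_of_nonneg (by positivity : (0 : ℝ) ≤ 1 / N)]
      refine mul_le_mul_of_nonneg_left ?_ (by positivity)
      rw [two_mul]
      exact (abs_sub _ _).trans (add_le_add (hf _) (hf _))
    have := h1.add ih
    rw [add_zero] at this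
    exact this.congr fun n => by rw [add_assoc]; ring

end Cesaro

/-! ### Independence of past and future noise -/

section Independence

variable {Ω : Type*} [MeasurableSpace Ω] {P : Measure Ω}

/-- The noise from time `m` on. -/
def futureNoise (w : ℕ → Ω → ℝ) (m : ℕ) (ω : Ω) : ℕ → ℝ := fun k => w (m + k) ω

/-- The initial data together with the noise before time `m`. -/
def past (z : Ω → ℝ × ℕ) (w : ℕ → Ω → ℝ) (m : ℕ) (ω : Ω) : (ℝ × ℕ) × (ℕ → ℝ) :=
  (z ω, fun k => if k < m then w k ω else 0)

/-- The law of the noise sequence. -/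
noncomputable def noiseLaw (σ : ℝ≥0) : Measure (ℕ → ℝ) :=
  Measure.infinitePi fun _ : ℕ => gaussianReal 0 (σ ^ 2)

instance (σ : ℝ≥0) : IsProbabilityMeasure (noiseLaw σ) := by
  unfold noiseLaw; infer_instance

/-- Both independence statements express that the joint law is the product of the three laws, up to
reassociation. -/
lemma indepFun_prodMk_of_indepFun_prodMk {α β γ : Type*} [MeasurableSpace α] [MeasurableSpace β]
    [MeasurableSpace γ] [IsProbabilityMeasure P] {X : Ω → α} {Y : Ω → β} {Z : Ω → γ}
    (hX : Measurable X) (hY : Measurable Y) (hZ : Measurable Z)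
    (h : IndepFun X (fun ω => (Y ω, Z ω)) P) (hYZ : IndepFun Y Z P) :
    IndepFun (fun ω => (X ω, Y ω)) Z P := by
  have hXY : IndepFun X Y P := h.comp measurable_id measurable_fst
  have := Measure.isProbabilityMeasure_map (μ := P) hX.aemeasurable
  have := Measure.isProbabilityMeasure_map (μ := P) hY.aemeasurable
  have := Measure.isProbabilityMeasure_map (μ := P) hZ.aemeasurable
  rw [indepFun_iff_map_prod_eq_prod_map_map (by fun_prop) (by fun_prop)] at h hYZ hXY ⊢
  rw [hYZ, ← Measure.prodAssoc_prod, ← hXY] at h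
  rw [← MeasurableEquiv.prodAssoc.map_measurableEquiv_injective.eq_iff, ← h,
    Measure.map_map (by fun_prop) (by fun_prop)]
  rfl

lemma indepFun_before_futureNoise {w : ℕ → Ω → ℝ} (hw : ∀ k, Measurable (w k))
    (hind : iIndepFun w P) (m : ℕ) :
    IndepFun (fun ω k => if k < m then w k ω else 0) (futureNoise w m) P := by
  have h := indep_iSup_of_disjoint (m := fun k => MeasurableSpace.comap (w k) inferInstance)
    (fun k => (hw k).comap_le) hind (S := Set.Iio m) (T := Set.Ici m)
    (Set.disjoint_left.2 fun k h1 h2 => not_le.2 (Set.mem_Iio.1 h1) (Set.mem_Ici.1 h2))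
  refine indep_of_indep_of_le_left (indep_of_indep_of_le_right h ?_) ?_
  · refine Measurable.comap_le (@measurable_pi_lambda _ _ _ (_) _ _ fun k => ?_)
    exact (comap_measurable (w (m + k))).mono
      (le_iSup₂_of_le (m + k) (Nat.le_add_right m k) le_rfl) le_rfl
  · refine Measurable.comap_le (@measurable_pi_lambda _ _ _ (_) _ _ fun k => ?_)
    by_cases hk : k < m
    · simp only [hk, if_true]
      exact (comap_measurable (w k)).mono (le_iSup₂_of_le k hk le_rfl) le_rfl
    · simp only [hk, if_false]
      exact measurable_const

lemma measurable_futureNoise {w : ℕ → Ω → ℝ} (hw : ∀ k, Measurable (w k)) (m : ℕ) :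
    Measurable (futureNoise w m) :=
  measurable_pi_iff.2 fun k => hw (m + k)

lemma measurable_past {z : Ω → ℝ × ℕ} {w : ℕ → Ω → ℝ} (hz : Measurable z)
    (hw : ∀ k, Measurable (w k)) (m : ℕ) : Measurable (past z w m) := by
  refine hz.prodMk (measurable_pi_iff.2 fun k => ?_)
  split_ifs
  · exact hw k
  · exact measurable_const

lemma map_futureNoise {w : ℕ → Ω → ℝ} {σ : ℝ≥0} (hw : ∀ k, Measurable (w k))
    (hind : iIndepFun w P) (hlaw : ∀ k, P.map (w k) = gaussianReal 0 (σ ^ 2)) (m : ℕ) :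
    P.map (futureNoise w m) = noiseLaw σ := by
  have h := (hind.precomp (add_right_injective m)).map_fun_eq_infinitePi_map fun k => hw (m + k)
  simp only [hlaw] at h
  exact h

lemma indepFun_past_futureNoise [IsProbabilityMeasure P] {z : Ω → ℝ × ℕ} {w : ℕ → Ω → ℝ}
    (hz : Measurable z) (hw : ∀ k, Measurable (w k)) (hind : iIndepFun w P)
    (hzw : IndepFun z (fun ω k => w k ω) P) (m : ℕ) :
    IndepFun (past z w m) (futureNoise w m) P := by
  have hb : Measurable fun ω k => if k < m then w k ω else 0 :=
    measurable_snd.comp (measurable_past hz hw m)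
  refine indepFun_prodMk_of_indepFun_prodMk hz hb (measurable_futureNoise hw m) ?_
    (indepFun_before_futureNoise hw hind m)
  have hψ : Measurable fun v : ℕ → ℝ =>
      ((fun k => if k < m then v k else 0 : ℕ → ℝ), (fun k => v (m + k) : ℕ → ℝ)) := by
    refine Measurable.prodMk (measurable_pi_iff.2 fun k => ?_) (by fun_prop)
    split_ifs <;> fun_prop
  exact hzw.comp measurable_id hψ

end Independence

section Past

variable {Ω : Type*} {x w : ℕ → Ω → ℝ} {r : ℕ → Ω → ℕ}

/-- The information available before the noise `w m` acts. -/
@[reducible]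
def pastSigma (x w : ℕ → Ω → ℝ) (r : ℕ → Ω → ℕ) (m : ℕ) : MeasurableSpace Ω :=
  MeasurableSpace.comap (past (fun ω => (x 0 ω, r 0 ω)) w m) inferInstance

lemma measurable_noise_pastSigma {k m : ℕ} (h : k < m) : Measurable[pastSigma x w r m] (w k) := by
  have h1 : Measurable[pastSigma x w r m] (past (fun ω => (x 0 ω, r 0 ω)) w m) :=
    comap_measurable _
  have h2 : Measurable fun p : (ℝ × ℕ) × (ℕ → ℝ) => p.2 k := by fun_prop
  have := h2.comp h1
  simpa [Function.comp_def, past, h] using this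

lemma measurable_init_pastSigma (m : ℕ) :
    Measurable[pastSigma x w r m] (x 0) ∧ Measurable[pastSigma x w r m] (r 0) := by
  have h1 : Measurable[pastSigma x w r m] (past (fun ω => (x 0 ω, r 0 ω)) w m) :=
    comap_measurable _
  have h2 : Measurable fun p : (ℝ × ℕ) × (ℕ → ℝ) => p.1.1 := by fun_prop
  have h3 : Measurable fun p : (ℝ × ℕ) × (ℕ → ℝ) => p.1.2 := by fun_prop
  exact ⟨h2.comp h1, h3.comp h1⟩

/-- Only w_m, …, w_{m+d-1} enter, all of them earlier than n. This is the source of orthogonality at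
distance d. -/
lemma measurable_dep_pastSigma {H : (ℕ → ℝ) → ℝ} {d : ℕ} (hH : Measurable H)
    (hdep : ∀ v v', (∀ k < d, v k = v' k) → H v = H v') {m n : ℕ} (hmn : m + d ≤ n) :
    Measurable[pastSigma x w r n] fun ω => H (futureNoise w m ω) := by
  have : (fun ω => H (futureNoise w m ω)) =
      fun ω => H fun k => if k < d then w (m + k) ω else 0 := by
    funext ω
    exact hdep _ _ fun k hk => by simp [futureNoise, hk]
  rw [this]
  let := pastSigma x w r n
  refine hH.comp (measurable_pi_iff.2 fun k => ?_)
  by_cases hk : k < d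
  · simp only [hk, if_true]
    exact measurable_noise_pastSigma (by omega)
  · simp only [hk, if_false]
    exact measurable_const

end Past

section Step

variable {Ω : Type*} {mΩ : MeasurableSpace Ω}

lemma measurable_next_state {a b K : ℝ} {X W : Ω → ℝ} {R : Ω → ℕ} (hX : Measurable X)
    (hR : Measurable R) (hW : Measurable W) :
    Measurable fun ω => a * X ω + b * (if R ω = 0 then K * X ω else 0) + W ω :=
  ((hX.const_mul a).add ((Measurable.ite (hR (measurableSet_singleton 0)) (hX.const_mul K)
    measurable_const).const_mul b)).add hW

lemma measurable_next_counter {ε : ℝ} {T : ℕ} {X : Ω → ℝ} {R : Ω → ℕ} (hX : Measurable X)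
    (hR : Measurable R) :
    Measurable fun ω => if ε < |X ω| ∨ T ≤ R ω then 0 else R ω + 1 :=
  Measurable.ite ((measurableSet_lt measurable_const hX.abs).union
    (measurableSet_le measurable_const hR)) measurable_const (hR.add_const 1)

end Step

/-! ### Averages of functionals of the noise after a transmission -/

section Loop

variable {Ω : Type*} [MeasurableSpace Ω] {P : Measure Ω} {a b K ε : ℝ} {T : ℕ} {σw σ0 : ℝ≥0}
  {x u w : ℕ → Ω → ℝ} {r : ℕ → Ω → ℕ}

namespace ClosedLoop

variable (hloop : ClosedLoop P a b K ε T σw σ0 x u w r)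
include hloop

lemma measurable_initial : Measurable fun ω => (x 0 ω, r 0 ω) :=
  hloop.measurable_init.prodMk hloop.measurable_counter_init

lemma pastSigma_le (m : ℕ) : pastSigma x w r m ≤ ‹MeasurableSpace Ω› :=
  (measurable_past hloop.measurable_initial hloop.measurable_noise m).comap_le

lemma measurable_state_counter (m : ℕ) : ∀ k ≤ m,
    Measurable[pastSigma x w r m] (x k) ∧ Measurable[pastSigma x w r m] (r k) := by
  intro k
  induction k with
  | zero => exact fun _ => measurable_init_pastSigma m
  | succ k ih =>
    intro hk
    obtain ⟨hx, hr⟩ := ih (by omega)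
    have hw := measurable_noise_pastSigma (x := x) (w := w) (r := r) (show k < m by omega)
    have hx' : Measurable[pastSigma x w r m] (x (k + 1)) := by
      rw [show x (k + 1) = fun ω => a * x k ω + b * (if r k ω = 0 then K * x k ω else 0) + w k ω
        from funext fun ω => by rw [hloop.state, hloop.input]]
      exact measurable_next_state hx hr hw
    refine ⟨hx', ?_⟩
    rw [show r (k + 1) = fun ω => if ε < |x (k + 1) ω| ∨ T ≤ r k ω then 0 else r k ω + 1 from
      funext (hloop.counter k)]
    exact measurable_next_counter hx' hr

lemma measurable_counter (k : ℕ) : Measurable (r k) :=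
  (hloop.measurable_state_counter k k le_rfl).2.mono (hloop.pastSigma_le k) le_rfl

lemma measurableSet_reset (m : ℕ) : MeasurableSet[pastSigma x w r m] {ω | r m ω = 0} :=
  (hloop.measurable_state_counter m m le_rfl).2 (measurableSet_singleton 0)

lemma measurable_future (m : ℕ) : Measurable (futureNoise w m) :=
  measurable_futureNoise hloop.measurable_noise m

lemma map_future (m : ℕ) : P.map (futureNoise w m) = noiseLaw σw :=
  map_futureNoise hloop.measurable_noise hloop.indep_noise hloop.law_noise m

lemma measurePreserving_future (m : ℕ) : MeasurePreserving (futureNoise w m) P (noiseLaw σw) :=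
  ⟨hloop.measurable_future m, hloop.map_future m⟩

lemma indep_past_future [IsProbabilityMeasure P] (m : ℕ) :
    Indep (pastSigma x w r m) (MeasurableSpace.comap (futureNoise w m) inferInstance) P :=
  indepFun_past_futureNoise hloop.measurable_initial hloop.measurable_noise hloop.indep_noise
    hloop.indep_init m

lemma measure_reset_inter_future [IsProbabilityMeasure P] (m : ℕ) {A : Set (ℕ → ℝ)}
    (hA : MeasurableSet A) {B : Set Ω} (hB : MeasurableSet[pastSigma x w r m] B) :
    P (B ∩ futureNoise w m ⁻¹' A) = P B * noiseLaw σw A := by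
  rw [Indep_iff _ _ P |>.1 (hloop.indep_past_future m) B _ hB ⟨A, hA, rfl⟩,
    ← hloop.map_future m, Measure.map_apply (hloop.measurable_future m) hA]

/-- Functionals of the noise following a transmission average out to their mean. -/
theorem ae_tendsto_average_reset [IsProbabilityMeasure P] {H : (ℕ → ℝ) → ℝ} {d : ℕ}
    (hH : Measurable H) (hH2 : MemLp H 2 (noiseLaw σw))
    (hdep : ∀ v v', (∀ k < d, v k = v' k) → H v = H v') :
    ∀ᵐ ω ∂P, Tendsto (fun N : ℕ => (1 / (N : ℝ)) * ∑ m ∈ Finset.range N,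
      if r m ω = 0 then H (futureNoise w m ω) - ∫ v, H v ∂noiseLaw σw else 0) atTop (𝓝 0) := by
  set c := ∫ v, H v ∂noiseLaw σw with hc
  set G : (ℕ → ℝ) → ℝ := fun v => H v - c with hG
  have hGm : Measurable G := hH.sub_const c
  have hG2 : MemLp G 2 (noiseLaw σw) := hH2.sub (memLp_const c)
  have hGdep : ∀ v v', (∀ k < d, v k = v' k) → G v = G v' := fun v v' h => by
    simp only [hG, hdep v v' h]
  have hG0 : ∫ v, G v ∂noiseLaw σw = 0 := by
    simp only [hG]
    rw [integral_sub (hH2.integrable one_le_two) (integrable_const c)]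
    simp [hc]
  have hGP : ∀ m, MemLp (fun ω => G (futureNoise w m ω)) 2 P := fun m =>
    hG2.comp_measurePreserving (hloop.measurePreserving_future m)
  have hreset : ∀ m, MeasurableSet {ω | r m ω = 0} := fun m =>
    hloop.measurable_counter m (measurableSet_singleton 0)
  have hD : ∀ m, MemLp (fun ω => if r m ω = 0 then G (futureNoise w m ω) else 0) 2 P := fun m => by
    convert (hGP m).indicator (hreset m) using 2 with ω
    simp [Set.indicator_apply]
  refine strong_law_of_orthogonal (d := d) (C := ∫ v, G v ^ 2 ∂noiseLaw σw) hD ?_ ?_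
  · intro m
    have : ∫ v, G v ^ 2 ∂noiseLaw σw = ∫ ω, G (futureNoise w m ω) ^ 2 ∂P := by
      rw [← hloop.map_future m, integral_map (hloop.measurable_future m).aemeasurable]
      exact (hGm.pow_const 2).aestronglyMeasurable
    rw [this]
    refine integral_mono (hD m).integrable_sq (hGP m).integrable_sq fun ω => ?_
    dsimp only
    split_ifs
    · rfl
    · simpa using sq_nonneg _
  · intro m n hmn
    -- The whole term at m and the indicator at n belong to the past of n. The remaining factor, a
    -- centred functional of the noise from n on, is independent of them, so the expectation factors
    -- and vanishes.
    have hpast : Measurable[pastSigma x w r n] fun ω =>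
        (if r m ω = 0 then G (futureNoise w m ω) else 0) * (if r n ω = 0 then 1 else 0) := by
      have h1 := measurable_dep_pastSigma (x := x) (w := w) (r := r) hGm hGdep hmn
      have h2 := (hloop.measurable_state_counter n m (by omega)).2
      have h3 := hloop.measurableSet_reset n
      let := pastSigma x w r n
      exact (Measurable.ite (h2 (measurableSet_singleton 0)) h1 measurable_const).mul
        (Measurable.ite h3 measurable_const measurable_const)
    have hind : IndepFun (fun ω =>
        (if r m ω = 0 then G (futureNoise w m ω) else 0) * (if r n ω = 0 then 1 else 0))
        (fun ω => G (futureNoise w n ω)) P := by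
      refine indep_of_indep_of_le_left (indep_of_indep_of_le_right
        (hloop.indep_past_future n) ?_) hpast.comap_le
      exact (hGm.comp (comap_measurable _)).comap_le
    have hmul := hind.integral_fun_mul_eq_mul_integral
      (hpast.mono (hloop.pastSigma_le n) le_rfl).aestronglyMeasurable (hGP n).1
    have hzero : ∫ ω, G (futureNoise w n ω) ∂P = 0 := by
      rw [← hG0, ← hloop.map_future n, integral_map (hloop.measurable_future n).aemeasurable]
      exact hGm.aestronglyMeasurable
    rw [hzero, mul_zero] at hmul
    refine Eq.trans (integral_congr_ae (ae_of_all _ fun ω => ?_)) hmul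
    by_cases hn : r n ω = 0 <;> simp [hn, hG]

end ClosedLoop

end Loop

/-! ### The process ξ and the events F on the space of noise sequences -/

section Noise

variable {a ε : ℝ} {σ : ℝ≥0}

/-- `ξ_i` as a function of the noise sequence. -/
def noiseXi (a : ℝ) (i : ℕ) (v : ℕ → ℝ) : ℝ :=
  ∑ j ∈ Finset.range (i + 1), a ^ j * v (i - j)

/-- The event `F_i` as a set of noise sequences. -/
def noiseF (a ε : ℝ) (i : ℕ) : Set (ℕ → ℝ) :=
  {v | ∀ j < i, |noiseXi a j v| ≤ ε}

lemma noiseXi_zero (v : ℕ → ℝ) : noiseXi a 0 v = v 0 := by simp [noiseXi]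

lemma noiseXi_succ (i : ℕ) (v : ℕ → ℝ) :
    noiseXi a (i + 1) v = a * noiseXi a i v + v (i + 1) := by
  unfold noiseXi
  rw [Finset.sum_range_succ', Finset.mul_sum]
  congr 1
  · refine Finset.sum_congr rfl fun j _ => ?_
    rw [Nat.add_sub_add_right]
    ring
  · simp

lemma noiseXi_congr (i : ℕ) {v v' : ℕ → ℝ} (h : ∀ k < i + 1, v k = v' k) :
    noiseXi a i v = noiseXi a i v' :=
  Finset.sum_congr rfl fun j _ => by rw [h _ (by omega)]

lemma noiseF_congr (i : ℕ) {v v' : ℕ → ℝ} (h : ∀ k < i, v k = v' k) :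
    v ∈ noiseF a ε i ↔ v' ∈ noiseF a ε i :=
  forall₂_congr fun j hj => by rw [noiseXi_congr j fun k hk => h k (by omega)]

lemma indicator_noiseF_congr {i : ℕ} {f : (ℕ → ℝ) → ℝ} {v v' : ℕ → ℝ}
    (h : ∀ k < i, v k = v' k) (hf : f v = f v') :
    (noiseF a ε i).indicator f v = (noiseF a ε i).indicator f v' := by
  by_cases hv : v ∈ noiseF a ε i
  · rw [Set.indicator_of_mem hv, Set.indicator_of_mem ((noiseF_congr i h).1 hv), hf]
  · rw [Set.indicator_of_notMem hv, Set.indicator_of_notMem (mt (noiseF_congr i h).2 hv)]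

lemma noiseXi_neg (i : ℕ) (v : ℕ → ℝ) : noiseXi a i (-v) = -noiseXi a i v := by
  simp [noiseXi]

lemma neg_mem_noiseF (i : ℕ) (v : ℕ → ℝ) : -v ∈ noiseF a ε i ↔ v ∈ noiseF a ε i := by
  simp [noiseF, noiseXi_neg]

lemma noiseF_zero : noiseF a ε 0 = Set.univ := by simp [noiseF]

lemma mem_noiseF_succ {i : ℕ} {v : ℕ → ℝ} :
    v ∈ noiseF a ε (i + 1) ↔ v ∈ noiseF a ε i ∧ |noiseXi a i v| ≤ ε :=
  Nat.forall_lt_succ_right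

lemma noiseF_succ_subset (i : ℕ) : noiseF a ε (i + 1) ⊆ noiseF a ε i :=
  fun _ h => (mem_noiseF_succ.1 h).1

lemma noiseF_diff (i : ℕ) :
    noiseF a ε i \ noiseF a ε (i + 1) = {v | ε < |noiseXi a i v|} ∩ noiseF a ε i := by
  ext v
  simp only [Set.mem_sdiff, mem_noiseF_succ, Set.mem_inter_iff, Set.mem_ofPred_eq]
  rw [← not_le]
  tauto

lemma measurable_noiseXi (i : ℕ) : Measurable (noiseXi a i) := by
  unfold noiseXi
  fun_prop

lemma measurableSet_noiseF (i : ℕ) : MeasurableSet (noiseF a ε i) := by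
  have : noiseF a ε i = ⋂ j ∈ Finset.range i, {v | |noiseXi a j v| ≤ ε} := by
    ext v; simp [noiseF]
  rw [this]
  exact Finset.measurableSet_biInter _ fun j _ =>
    measurableSet_le (measurable_noiseXi j).abs measurable_const

lemma map_eval_noiseLaw (i : ℕ) : (noiseLaw σ).map (fun v => v i) = gaussianReal 0 (σ ^ 2) :=
  Measure.infinitePi_map_eval _ i

lemma iIndepFun_eval_noiseLaw : iIndepFun (fun i (v : ℕ → ℝ) => v i) (noiseLaw σ) :=
  iIndepFun_infinitePi (X := fun _ y => y) fun _ => measurable_id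

lemma memLp_eval_noiseLaw (i : ℕ) {p : ℝ≥0∞} (hp : p ≠ ⊤) :
    MemLp (fun v : ℕ → ℝ => v i) p (noiseLaw σ) :=
  (memLp_id_gaussianReal' (μ := 0) (v := σ ^ 2) p hp).comp_measurePreserving
    ⟨measurable_pi_apply i, map_eval_noiseLaw i⟩

lemma memLp_noiseXi (i : ℕ) {p : ℝ≥0∞} (hp : p ≠ ⊤) : MemLp (noiseXi a i) p (noiseLaw σ) :=
  memLp_finsetSum _ fun j _ => (memLp_eval_noiseLaw (i - j) hp).const_mul (a ^ j)

lemma map_neg_noiseLaw : (noiseLaw σ).map (fun v => -v) = noiseLaw σ := by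
  have := Measure.infinitePi_map_pi (fun _ : ℕ => gaussianReal 0 (σ ^ 2))
    (f := fun _ x => -x) fun _ => measurable_neg
  simp only [gaussianReal_map_neg, neg_zero] at this
  exact this

/-- The noise law is invariant under v ↦ -v and ξ_i is odd. This is what turns conditional second
moments into variances. -/
lemma setIntegral_noiseXi_eq_zero (i : ℕ) {A : Set (ℕ → ℝ)} (hA : MeasurableSet A)
    (hsymm : ∀ v, -v ∈ A ↔ v ∈ A) : ∫ v in A, noiseXi a i v ∂noiseLaw σ = 0 := by
  rw [← integral_indicator hA]
  have h1 : ∫ v, A.indicator (noiseXi a i) v ∂noiseLaw σ =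
      ∫ v, A.indicator (noiseXi a i) (-v) ∂noiseLaw σ := by
    conv_lhs => rw [← map_neg_noiseLaw]
    exact integral_map (by fun_prop) ((measurable_noiseXi i).indicator hA).aestronglyMeasurable
  have h2 : ∀ v, A.indicator (noiseXi a i) (-v) = -A.indicator (noiseXi a i) v := fun v => by
    by_cases hv : v ∈ A
    · rw [Set.indicator_of_mem hv, Set.indicator_of_mem ((hsymm v).2 hv), noiseXi_neg]
    · rw [Set.indicator_of_notMem hv, Set.indicator_of_notMem (mt (hsymm v).1 hv), neg_zero]
  simp_rw [h2, integral_neg] at h1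
  linarith

lemma gaussianReal_pos_of_isOpen (hσ : 0 < σ) {U : Set ℝ} (hU : IsOpen U) (hne : U.Nonempty) :
    0 < gaussianReal 0 (σ ^ 2) U := by
  have hσ2 : σ ^ 2 ≠ 0 := (pow_pos hσ 2).ne'
  refine pos_iff_ne_zero.2 fun h => ?_
  exact (hU.measure_pos volume hne).ne' (gaussianReal_absolutelyContinuous' 0 hσ2 h)

lemma noiseLaw_noiseF_pos (hσ : 0 < σ) (hε : 0 < ε) (i : ℕ) : 0 < noiseLaw σ (noiseF a ε i) := by
  set M : ℝ := ∑ j ∈ Finset.range i, |a| ^ j with hM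
  have hM0 : 0 ≤ M := Finset.sum_nonneg fun j _ => by positivity
  -- If all noise values are below δ in modulus, each |ξ_j| with j < i is at most Mδ ≤ ε. The + 1
  -- keeps the denominator positive when i = 0.
  set δ : ℝ := ε / (M + 1) with hδ
  have hδ0 : 0 < δ := by positivity
  have hsub : (Finset.range i : Set ℕ).pi (fun _ => Set.Ioo (-δ) δ) ⊆ noiseF a ε i := by
    intro v hv j hj
    have hv' : ∀ k < i, |v k| ≤ δ := fun k hk =>
      (abs_lt.2 (hv k (by simpa using hk))).le
    calc |noiseXi a j v| ≤ ∑ l ∈ Finset.range (j + 1), |a ^ l * v (j - l)| :=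
          Finset.abs_sum_le_sum_abs _ _
      _ ≤ ∑ l ∈ Finset.range (j + 1), |a| ^ l * δ := by
          refine Finset.sum_le_sum fun l _ => ?_
          rw [abs_mul, abs_pow]
          exact mul_le_mul_of_nonneg_left (hv' _ (by omega)) (by positivity)
      _ ≤ M * δ := by
          rw [← Finset.sum_mul]
          refine mul_le_mul_of_nonneg_right ?_ hδ0.le
          exact Finset.sum_le_sum_of_subset_of_nonneg
            (Finset.range_mono (by omega)) fun _ _ _ => by positivity
      _ ≤ (M + 1) * δ := by nlinarith
      _ = ε := by rw [hδ]; field_simp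
  refine lt_of_lt_of_le ?_ (measure_mono hsub)
  rw [noiseLaw, Measure.infinitePi_pi _ fun _ _ => measurableSet_Ioo]
  refine pos_iff_ne_zero.2 (Finset.prod_ne_zero_iff.2 fun k _ => ?_)
  exact (gaussianReal_pos_of_isOpen hσ isOpen_Ioo ⟨0, by simp [hδ0]⟩).ne'

lemma integral_eval_noiseLaw (i : ℕ) : ∫ v, v i ∂noiseLaw σ = 0 := by
  have h := integral_id_gaussianReal (μ := 0) (v := σ ^ 2)
  rw [← map_eval_noiseLaw i, integral_map (measurable_pi_apply i).aemeasurable (by fun_prop)] at h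
  exact h

lemma integral_eval_sq_noiseLaw (i : ℕ) : ∫ v, v i ^ 2 ∂noiseLaw σ = (σ : ℝ) ^ 2 := by
  have h := variance_id_gaussianReal (μ := 0) (v := σ ^ 2)
  rw [variance_of_integral_eq_zero aemeasurable_id integral_id_gaussianReal,
    ← map_eval_noiseLaw i, integral_map (measurable_pi_apply i).aemeasurable (by fun_prop)] at h
  simpa using h

lemma indepFun_eval_noiseLaw {f : (ℕ → ℝ) → ℝ} (hf : Measurable f) {i : ℕ}
    (hdep : ∀ v v', (∀ k < i, v k = v' k) → f v = f v') {g : ℝ → ℝ} (hg : Measurable g) :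
    IndepFun f (fun v => g (v i)) (noiseLaw σ) := by
  have h := indepFun_before_futureNoise (w := fun k (v : ℕ → ℝ) => v k) (P := noiseLaw σ)
    (fun k => measurable_pi_apply k) iIndepFun_eval_noiseLaw i
  have h2 := h.comp hf (hg.comp (measurable_pi_apply 0))
  have e : (f ∘ fun ω k => if k < i then ω k else 0) = f := by
    funext v
    exact hdep _ _ fun k hk => by simp [hk]
  rw [e] at h2
  exact h2

/-- F_{n+1} and ξ_n are determined by v 0, …, v n, so the fresh noise v (n + 1) is independent of
them and the cross term vanishes. This yields the time-out variance Σ_T^c. -/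
lemma setIntegral_noiseXi_succ_sq (n : ℕ) :
    ∫ v in noiseF a ε (n + 1), noiseXi a (n + 1) v ^ 2 ∂noiseLaw σ =
      a ^ 2 * ∫ v in noiseF a ε (n + 1), noiseXi a n v ^ 2 ∂noiseLaw σ +
        (σ : ℝ) ^ 2 * (noiseLaw σ).real (noiseF a ε (n + 1)) := by
  set F := noiseF a ε (n + 1) with hF
  have hFm : MeasurableSet F := measurableSet_noiseF _
  have hXi : MemLp (noiseXi a n) 2 (noiseLaw σ) := memLp_noiseXi n (by simp)
  have hv : MemLp (fun v : ℕ → ℝ => v (n + 1)) 2 (noiseLaw σ) :=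
    memLp_eval_noiseLaw _ (by simp)
  have hcross : ∫ v in F, noiseXi a n v * v (n + 1) ∂noiseLaw σ = 0 := by
    have hind : IndepFun (F.indicator (noiseXi a n)) (fun v => v (n + 1)) (noiseLaw σ) := by
      refine indepFun_eval_noiseLaw ((measurable_noiseXi n).indicator hFm) (fun v v' h => ?_)
        measurable_id
      exact indicator_noiseF_congr h (noiseXi_congr n h)
    have := hind.integral_fun_mul_eq_mul_integral
      ((measurable_noiseXi n).indicator hFm).aestronglyMeasurable hv.1
    rw [integral_eval_noiseLaw, mul_zero] at this
    rw [← integral_indicator hFm, ← this]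
    refine integral_congr_ae (ae_of_all _ fun v => ?_)
    by_cases hvF : v ∈ F <;> simp [hvF]
  have hsq : ∫ v in F, v (n + 1) ^ 2 ∂noiseLaw σ = (σ : ℝ) ^ 2 * (noiseLaw σ).real F := by
    have hind : IndepFun (F.indicator fun _ => (1 : ℝ)) (fun v => v (n + 1) ^ 2) (noiseLaw σ) := by
      refine indepFun_eval_noiseLaw (g := fun y => y ^ 2) (measurable_const.indicator hFm)
        (fun v v' h => ?_) (by fun_prop)
      exact indicator_noiseF_congr h rfl
    have := hind.integral_fun_mul_eq_mul_integral
      (measurable_const.indicator hFm).aestronglyMeasurable hv.integrable_sq.1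
    rw [integral_eval_sq_noiseLaw, integral_indicator hFm, setIntegral_const, smul_eq_mul,
      mul_one] at this
    rw [← integral_indicator hFm, mul_comm, ← this]
    refine integral_congr_ae (ae_of_all _ fun v => ?_)
    by_cases hvF : v ∈ F <;> simp [hvF]
  have i1 : IntegrableOn (fun v => a ^ 2 * noiseXi a n v ^ 2) F (noiseLaw σ) :=
    (hXi.integrable_sq.const_mul _).integrableOn
  have i2 : IntegrableOn (fun v => 2 * a * (noiseXi a n v * v (n + 1))) F (noiseLaw σ) :=
    ((hXi.integrable_mul hv).const_mul _).integrableOn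
  have i3 : IntegrableOn (fun v : ℕ → ℝ => v (n + 1) ^ 2) F (noiseLaw σ) :=
    hv.integrable_sq.integrableOn
  have e : ∀ v, noiseXi a (n + 1) v ^ 2 =
      a ^ 2 * noiseXi a n v ^ 2 + 2 * a * (noiseXi a n v * v (n + 1)) + v (n + 1) ^ 2 :=
    fun v => by rw [noiseXi_succ]; ring
  simp_rw [e]
  have i12 : IntegrableOn
      (fun v => a ^ 2 * noiseXi a n v ^ 2 + 2 * a * (noiseXi a n v * v (n + 1))) F (noiseLaw σ) :=
    i1.add i2
  rw [integral_add i12 i3, integral_add i1 i2, integral_const_mul, integral_const_mul,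
    hcross, hsq]
  ring

end Noise

section CondVariance

variable {Ω : Type*} [MeasurableSpace Ω] {P : Measure Ω} [IsProbabilityMeasure P]

/-- The conditional mean is zero, so the variance is a second moment. The factor `P.real A` cancels
the normalisation and makes the identity hold for null `A` too. -/
lemma measureReal_mul_variance_cond {X : Ω → ℝ} {A : Set Ω} (hX : Measurable X)
    (h0 : ∫ ω in A, X ω ∂P = 0) :
    P.real A * variance X (cond P A) = ∫ ω in A, X ω ^ 2 ∂P := by
  by_cases hA : P A = 0
  · simp [measureReal_def, hA, Measure.restrict_eq_zero.2 hA]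
  have hmean : ∫ ω, X ω ∂(cond P A) = 0 := by
    rw [ProbabilityTheory.cond, integral_smul_measure, h0, smul_zero]
  rw [variance_of_integral_eq_zero hX.aemeasurable hmean, ProbabilityTheory.cond,
    integral_smul_measure, smul_eq_mul, ← mul_assoc, ENNReal.toReal_inv, measureReal_def,
    mul_inv_cancel₀ (ENNReal.toReal_ne_zero.2 ⟨hA, measure_ne_top _ _⟩), one_mul]

end CondVariance

lemma noiseXi_futureNoise_zero {Ω : Type*} {a : ℝ} (w : ℕ → Ω → ℝ) (i : ℕ) (ω : Ω) :
    noiseXi a i (futureNoise w 0 ω) = xi a w i ω := by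
  simp [futureNoise, noiseXi, xi]

lemma preimage_noiseF {Ω : Type*} {a ε : ℝ} (w : ℕ → Ω → ℝ) (i : ℕ) :
    futureNoise w 0 ⁻¹' noiseF a ε i = eventF a ε w i := by
  ext ω
  simp [noiseF, eventF, noiseXi_futureNoise_zero]

namespace ClosedLoop

variable {Ω : Type*} [MeasurableSpace Ω] {P : Measure Ω} {a b K ε : ℝ} {T : ℕ} {σw σ0 : ℝ≥0}
  {x u w : ℕ → Ω → ℝ} {r : ℕ → Ω → ℕ}

/-! ### Path structure between transmissions -/

section Pathwise

variable (hloop : ClosedLoop P a b K ε T σw σ0 x u w r)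
include hloop

lemma state_succ (hb : b ≠ 0) (hK : K = -a / b) (k : ℕ) (ω : Ω) :
    x (k + 1) ω = (if r k ω = 0 then 0 else a * x k ω) + w k ω := by
  rw [hloop.state, hloop.input]
  split_ifs
  · rw [hK]; field_simp; ring
  · ring

lemma counter_eq_of_succ {k i : ℕ} {ω : Ω} (h : r (k + 1) ω = i + 1) : r k ω = i := by
  rw [hloop.counter] at h
  split_ifs at h
  omega

/-- A positive counter value can only come from the value one below it, so i is reached at time m +
i by an unbroken climb from 0. -/
lemma counter_eq_zero_of_add {m i : ℕ} {ω : Ω} (h : r (m + i) ω = i) : r m ω = 0 := by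
  induction i with
  | zero => exact h
  | succ i ih => exact ih (hloop.counter_eq_of_succ h)

lemma counter_succ_le (k : ℕ) (ω : Ω) : r (k + 1) ω ≤ T := by
  rw [hloop.counter]
  split_ifs <;> omega

/-- The two claims need a joint induction: survival of the next step is decided by the state, and
the formula for the state holds only while the counter has survived. The bound i ≤ T rules out a
time-out on the way. -/
lemma counter_add_and_state (hb : b ≠ 0) (hK : K = -a / b) {m : ℕ} {ω : Ω} (hr : r m ω = 0) :
    ∀ i ≤ T, (r (m + i) ω = i ↔ futureNoise w m ω ∈ noiseF a ε i) ∧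
      (r (m + i) ω = i → x (m + i + 1) ω = noiseXi a i (futureNoise w m ω)) := by
  intro i
  induction i with
  | zero =>
    refine fun _ => ⟨by simp [hr, noiseF_zero], fun _ => ?_⟩
    rw [add_zero, hloop.state_succ hb hK, if_pos hr, noiseXi_zero, zero_add]
    rfl
  | succ i ih =>
    intro hi
    obtain ⟨h1, h2⟩ := ih (by omega)
    refine ⟨?_, fun h => ?_⟩
    · rw [mem_noiseF_succ, ← h1]
      refine ⟨fun h => ?_, fun h => ?_⟩
      · have h' := hloop.counter_eq_of_succ h
        refine ⟨h', ?_⟩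
        rw [← h2 h']
        rw [← add_assoc, hloop.counter] at h
        split_ifs at h with h3
        exact not_lt.1 fun h4 => h3 (Or.inl h4)
      · rw [← add_assoc, hloop.counter, if_neg, h.1]
        rw [h2 h.1, h.1]
        push Not
        exact ⟨h.2, by omega⟩
    · have h' := hloop.counter_eq_of_succ h
      rw [hloop.state_succ hb hK, if_neg (by omega), ← add_assoc, h2 h', noiseXi_succ]
      rfl

lemma counter_add_iff (hb : b ≠ 0) (hK : K = -a / b) {m i : ℕ} (hi : i ≤ T) (ω : Ω) :
    r (m + i) ω = i ↔ r m ω = 0 ∧ futureNoise w m ω ∈ noiseF a ε i :=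
  ⟨fun h => ⟨hloop.counter_eq_zero_of_add h,
    (hloop.counter_add_and_state hb hK (hloop.counter_eq_zero_of_add h) i hi).1.1 h⟩,
    fun h => (hloop.counter_add_and_state hb hK h.1 i hi).1.2 h.2⟩

lemma state_of_counter_add (hb : b ≠ 0) (hK : K = -a / b) {m i : ℕ} (hi : i ≤ T) {ω : Ω}
    (h : r (m + i) ω = i) : x (m + i + 1) ω = noiseXi a i (futureNoise w m ω) :=
  (hloop.counter_add_and_state hb hK (hloop.counter_eq_zero_of_add h) i hi).2 h

/-- Exactly one i ≤ T equals r_k, and only that term survives. The condition T < k keeps k - i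
untruncated and excludes k = 0, where the counter may exceed T. -/
lemma sum_reset_indicator (hb : b ≠ 0) (hK : K = -a / b) (φ : ℕ → (ℕ → ℝ) → ℝ) (c : ℝ) (ω : Ω)
    {k : ℕ} (hk : T < k)
    (hφ : ∀ m i, m + i = k → r k ω = i → φ i (futureNoise w m ω) = c) :
    ∑ i ∈ Finset.range (T + 1),
      (if r (k - i) ω = 0 then (noiseF a ε i).indicator (φ i) (futureNoise w (k - i) ω) else 0)
      = c := by
  have hrk : r k ω ≤ T := by
    obtain ⟨k, rfl⟩ : ∃ l, k = l + 1 := ⟨k - 1, by omega⟩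
    exact hloop.counter_succ_le k ω
  have hterm : ∀ i ∈ Finset.range (T + 1),
      (if r (k - i) ω = 0 then (noiseF a ε i).indicator (φ i) (futureNoise w (k - i) ω) else 0)
        = if r k ω = i then c else 0 := by
    intro i hi
    have hiT : i ≤ T := Nat.lt_succ_iff.1 (Finset.mem_range.1 hi)
    have hki : k - i + i = k := by omega
    have hiff := hloop.counter_add_iff hb hK (m := k - i) hiT ω
    rw [hki] at hiff
    by_cases h : r k ω = i
    · obtain ⟨h0, hF⟩ := hiff.1 h
      rw [if_pos h, if_pos h0, Set.indicator_of_mem hF, hφ _ _ hki h]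
    · rw [if_neg h]
      split_ifs with h0
      · rw [Set.indicator_of_notMem]
        exact fun hF => h (hiff.2 ⟨h0, hF⟩)
      · rfl
  rw [Finset.sum_congr rfl hterm, Finset.sum_ite_eq, if_pos (Finset.mem_range.2 (by omega))]

end Pathwise

/-! ### Transition probabilities of the counter -/

section Probability

variable [IsProbabilityMeasure P] (hloop : ClosedLoop P a b K ε T σw σ0 x u w r)
include hloop

/-- Here x_{m+1} = Y + w_m with Y independent of w_m. If Y ≥ 0, noise above ε crosses the threshold;
if Y < 0, noise below -ε does. Were a transmission null, both {Y ≥ 0} and {Y < 0} would be null. -/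
lemma measure_reset_pos (hb : b ≠ 0) (hK : K = -a / b) (hσ : 0 < σw) (m : ℕ) :
    P {ω | r (m + 1) ω = 0} ≠ 0 := by
  intro h0
  have hpos : ∀ U : Set ℝ, IsOpen U → U.Nonempty →
      noiseLaw σw ((fun v : ℕ → ℝ => v 0) ⁻¹' U) ≠ 0 := by
    intro U hU hne
    rw [← Measure.map_apply (measurable_pi_apply 0) hU.measurableSet, map_eval_noiseLaw]
    exact (gaussianReal_pos_of_isOpen hσ hU hne).ne'
  have hx := (hloop.measurable_state_counter m m le_rfl).1
  have hr := hloop.measurableSet_reset m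
  set Y : Ω → ℝ := fun ω => if r m ω = 0 then 0 else a * x m ω with hY
  have hYm : Measurable[pastSigma x w r m] Y := Measurable.ite hr measurable_const (hx.const_mul a)
  have hnull : ∀ V U : Set ℝ, MeasurableSet V → IsOpen U → U.Nonempty →
      (∀ y ∈ V, ∀ s ∈ U, ε < |y + s|) → P (Y ⁻¹' V) = 0 := by
    intro V U hV hU hne hVU
    have h1 := hloop.measure_reset_inter_future m (hU.measurableSet.preimage (measurable_pi_apply 0))
      (hYm hV)
    have h2 : P (Y ⁻¹' V ∩ futureNoise w m ⁻¹' ((fun v : ℕ → ℝ => v 0) ⁻¹' U)) = 0 := by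
      refine measure_mono_null (fun ω hω => ?_) h0
      rw [Set.mem_ofPred_eq, hloop.counter, if_pos]
      left
      rw [hloop.state_succ hb hK]
      exact hVU _ hω.1 _ hω.2
    rw [h2] at h1
    exact (mul_eq_zero.1 h1.symm).resolve_right (hpos U hU hne)
  have hge := hnull (Set.Ici 0) (Set.Ioi ε) measurableSet_Ici isOpen_Ioi ⟨ε + 1, by simp⟩
    fun y hy s hs => lt_abs.2 (Or.inl (by
      rw [Set.mem_Ici] at hy
      rw [Set.mem_Ioi] at hs
      linarith))
  have hlt := hnull (Set.Iio 0) (Set.Iio (-ε)) measurableSet_Iio isOpen_Iio ⟨-ε - 1, by simp⟩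
    fun y hy s hs => lt_abs.2 (Or.inr (by
      rw [Set.mem_Iio] at hy hs
      linarith))
  have : P Set.univ = 0 := by
    rw [← Set.preimage_univ (f := Y), ← Set.Iio_union_Ici (a := (0 : ℝ)), Set.preimage_union]
    exact measure_union_null hlt hge
  simp at this

lemma measure_counter_eq (hb : b ≠ 0) (hK : K = -a / b) {m i : ℕ} (hi : i ≤ T) :
    P {ω | r (m + i) ω = i} = P {ω | r m ω = 0} * noiseLaw σw (noiseF a ε i) := by
  rw [← hloop.measure_reset_inter_future m (measurableSet_noiseF i) (hloop.measurableSet_reset m)]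
  congr 1
  ext ω
  exact hloop.counter_add_iff hb hK hi ω

omit [IsProbabilityMeasure P] in
lemma measureReal_eventF (i : ℕ) :
    P.real (eventF a ε w i) = (noiseLaw σw).real (noiseF a ε i) := by
  rw [← preimage_noiseF, measureReal_def, measureReal_def, ← hloop.map_future 0,
    Measure.map_apply (hloop.measurable_future 0) (measurableSet_noiseF i)]

omit [IsProbabilityMeasure P] in
lemma resetProb_of_lt {i : ℕ} (hi : i < T) :
    resetProb P a ε T w i =
      1 - (noiseLaw σw).real (noiseF a ε (i + 1)) / (noiseLaw σw).real (noiseF a ε i) := by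
  rw [resetProb, if_pos hi, hloop.measureReal_eventF, hloop.measureReal_eventF]

theorem transition_probability (hb : b ≠ 0) (hK : K = -a / b) (hσ : 0 < σw) (hε : 0 < ε) {k : ℕ}
    (hk : T < k) (i j : Fin (T + 1)) :
    P {ω | r k ω = i} ≠ 0 ∧
      (cond P {ω | r k ω = i}).real {ω | r (k + 1) ω = j} = transMatrix P a ε T w i j := by
  obtain ⟨i, hi⟩ := i
  obtain ⟨j, hj⟩ := j
  -- Since i ≤ T < k, the latest transmission falls at a time m + 1 ≥ 1, where `measure_reset_pos`
  -- applies; at time 0 the counter may be almost surely 1.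
  obtain ⟨m, rfl⟩ : ∃ m, k = m + 1 + i := ⟨k - 1 - i, by omega⟩
  simp only
  have hiT : i ≤ T := by omega
  have hm := hloop.measure_reset_pos hb hK hσ m
  have hF : ∀ l, 0 < (noiseLaw σw).real (noiseF a ε l) := fun l =>
    ENNReal.toReal_pos (noiseLaw_noiseF_pos hσ hε l).ne' (measure_ne_top _ _)
  have hmR : 0 < P.real {ω | r (m + 1) ω = 0} := ENNReal.toReal_pos hm (measure_ne_top _ _)
  have hne : P {ω | r (m + 1 + i) ω = i} ≠ 0 := by
    rw [hloop.measure_counter_eq hb hK hiT]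
    exact mul_ne_zero hm (noiseLaw_noiseF_pos hσ hε i).ne'
  refine ⟨hne, ?_⟩
  have hA : MeasurableSet {ω | r (m + 1 + i) ω = i} :=
    hloop.measurable_counter _ (measurableSet_singleton i)
  have hreal : ∀ l ≤ T, P.real {ω | r (m + 1 + l) ω = l} =
      P.real {ω | r (m + 1) ω = 0} * (noiseLaw σw).real (noiseF a ε l) := fun l hl => by
    simp only [measureReal_def]
    rw [hloop.measure_counter_eq hb hK hl, ENNReal.toReal_mul]
  have hAR : P.real {ω | r (m + 1 + i) ω = i} ≠ 0 :=
    ENNReal.toReal_ne_zero.2 ⟨hne, measure_ne_top _ _⟩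
  rw [measureReal_def, cond_apply hA, ENNReal.toReal_mul, ENNReal.toReal_inv, ← measureReal_def,
    ← measureReal_def]
  have hstep : ∀ ω, r (m + 1 + i + 1) ω = 0 ∨ r (m + 1 + i + 1) ω = r (m + 1 + i) ω + 1 := by
    intro ω
    rw [hloop.counter]
    split_ifs
    · exact Or.inl rfl
    · exact Or.inr rfl
  have hsub : {ω | r (m + 1 + (i + 1)) ω = i + 1} ⊆ {ω | r (m + 1 + i) ω = i} := fun ω h =>
    hloop.counter_eq_of_succ h
  unfold transMatrix
  simp only
  split_ifs with h1 h2
  · subst h1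
    rcases hiT.lt_or_eq with hlt | heq
    · have hset : {ω | r (m + 1 + i) ω = i} ∩ {ω | r (m + 1 + i + 1) ω = 0} =
          {ω | r (m + 1 + i) ω = i} \ {ω | r (m + 1 + (i + 1)) ω = i + 1} := by
        ext ω
        have := hstep ω
        simp only [Set.mem_inter_iff, Set.mem_sdiff, Set.mem_ofPred_eq, ← add_assoc]
        omega
      rw [hset, measureReal_sdiff hsub (hloop.measurable_counter _ (measurableSet_singleton _)),
        hreal i hiT, hreal (i + 1) hlt, hloop.resetProb_of_lt hlt]
      have := (hF i).ne'
      have := hmR.ne'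
      field_simp
    · have hset : {ω | r (m + 1 + i) ω = i} ∩ {ω | r (m + 1 + i + 1) ω = 0} =
          {ω | r (m + 1 + i) ω = i} := by
        refine Set.inter_eq_left.2 fun ω h => ?_
        rw [Set.mem_ofPred_eq] at h ⊢
        rw [hloop.counter, if_pos (Or.inr (by omega))]
      rw [hset, resetProb, if_neg (by omega), inv_mul_cancel₀ hAR]
  · have hset : {ω | r (m + 1 + i) ω = i} ∩ {ω | r (m + 1 + i + 1) ω = j} =
        {ω | r (m + 1 + (i + 1)) ω = i + 1} := by
      rw [h2]
      exact Set.inter_eq_right.2 hsub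
    rw [hset, hreal i hiT, hreal (i + 1) (by omega), hloop.resetProb_of_lt (by omega)]
    have := (hF i).ne'
    have := hmR.ne'
    field_simp
    ring
  · have hset : {ω | r (m + 1 + i) ω = i} ∩ {ω | r (m + 1 + i + 1) ω = j} = ∅ := by
      refine Set.eq_empty_of_forall_notMem fun ω hω => ?_
      obtain ⟨hωi, hωj⟩ : r (m + 1 + i) ω = i ∧ r (m + 1 + i + 1) ω = j := hω
      have := hstep ω
      omega
    rw [hset, measureReal_empty, mul_zero]

end Probability

end ClosedLoop

/-! ### Invariant distribution of the counter -/

section ResetChain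

lemma prod_one_sub_resetProb {p q : ℕ → ℝ} {T : ℕ} (hq0 : q 0 = 1) (hq : ∀ i, 0 < q i)
    (hp : ∀ i < T, p i = 1 - q (i + 1) / q i) :
    ∀ i ≤ T, ∏ j ∈ Finset.range i, (1 - p j) = q i := by
  intro i
  induction i with
  | zero => simp [hq0]
  | succ i ih =>
    intro hi
    rw [Finset.prod_range_succ, ih (by omega), hp i (by omega)]
    have := (hq i).ne'
    field_simp
    ring

/-- A chain on `{0, …, T}` moving from `i` to `0` or `i + 1` has a unique invariant distribution,
proportional to the survival probabilities `q i`. -/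
lemma invariant_iff_eq_survival {p q : ℕ → ℝ} {T : ℕ} (hq0 : q 0 = 1) (hq : ∀ i, 0 < q i)
    (hp : ∀ i < T, p i = 1 - q (i + 1) / q i) (hpT : p T = 1)
    {M : Matrix (Fin (T + 1)) (Fin (T + 1)) ℝ}
    (hM : ∀ i j, M i j = if (j : ℕ) = 0 then p i else
      if (j : ℕ) = (i : ℕ) + 1 then 1 - p i else 0)
    (μ : Fin (T + 1) → ℝ) :
    (μ ∈ stdSimplex ℝ (Fin (T + 1)) ∧ μ ᵥ* M = μ) ↔
      μ = fun i : Fin (T + 1) => q i / ∑ j ∈ Finset.range (T + 1), q j := by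
  set Q := ∑ j ∈ Finset.range (T + 1), q j with hQ
  have hQ0 : 0 < Q := Finset.sum_pos (fun i _ => hq i) (by simp)
  -- State l + 1 can be entered only from l, so its balance equation is a one-term recursion.
  have hsucc : ∀ (ν : Fin (T + 1) → ℝ) (l : ℕ) (hl : l + 1 < T + 1),
      (ν ᵥ* M) ⟨l + 1, hl⟩ = ν ⟨l, by omega⟩ * (q (l + 1) / q l) := by
    intro ν l hl
    rw [Matrix.vecMul, dotProduct, Finset.sum_eq_single ⟨l, by omega⟩]
    · simp [hM, hp l (by omega)]
    · intro i _ hi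
      have : ¬ l = (i : ℕ) := fun h => hi (Fin.ext h.symm)
      simp [hM, this]
    · simp
  have hzero : ∀ ν : Fin (T + 1) → ℝ, (ν ᵥ* M) 0 = ∑ i, ν i * p i := by
    intro ν
    simp [Matrix.vecMul, dotProduct, hM]
  constructor
  · rintro ⟨⟨-, hsum⟩, hinv⟩
    have hprop : ∀ l (hl : l < T + 1), μ ⟨l, hl⟩ = μ 0 * q l := by
      intro l
      induction l with
      | zero => intro _; rw [hq0, mul_one]; rfl
      | succ l ih =>
        intro hl
        rw [← congrFun hinv, hsucc, ih (by omega)]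
        have := (hq l).ne'
        field_simp
    have h0 : μ 0 * Q = 1 := by
      rw [← hsum, hQ, Finset.mul_sum, ← Fin.sum_univ_eq_sum_range]
      exact Finset.sum_congr rfl fun i _ => (hprop i i.2).symm
    funext i
    rw [eq_div_iff hQ0.ne', hprop i i.2, mul_right_comm, h0, one_mul]
  · rintro rfl
    refine ⟨⟨fun i => (div_pos (hq i) hQ0).le, ?_⟩, funext fun i => ?_⟩
    · rw [← Finset.sum_div, Fin.sum_univ_eq_sum_range, div_self hQ0.ne']
    · obtain ⟨l, hl⟩ := i
      cases l with
      | zero =>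
        refine (hzero _).trans ?_
        rw [Fin.sum_univ_eq_sum_range (fun i => q i / Q * p i), Finset.sum_range_succ, hpT]
        have : ∀ i ∈ Finset.range T, q i / Q * p i = (q i - q (i + 1)) / Q := by
          intro i hi
          rw [hp i (Finset.mem_range.1 hi)]
          have := (hq i).ne'
          field_simp
        rw [Finset.sum_congr rfl this, ← Finset.sum_div, Finset.sum_range_sub']
        simp only
        ring
      | succ l =>
        rw [hsucc]
        have := (hq l).ne'
        field_simp

end ResetChain

/-! ### Second moments, transmission frequency and average cost -/

namespace ClosedLoop

variable {Ω : Type*} [MeasurableSpace Ω] {P : Measure Ω} {a b K ε : ℝ} {T : ℕ} {σw σ0 : ℝ≥0}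
  {x u w : ℕ → Ω → ℝ} {r : ℕ → Ω → ℕ}
  [IsProbabilityMeasure P] (hloop : ClosedLoop P a b K ε T σw σ0 x u w r)
include hloop

lemma measureReal_mul_variance_xi (i : ℕ) {A : Set (ℕ → ℝ)} (hA : MeasurableSet A)
    (hsymm : ∀ v, -v ∈ A ↔ v ∈ A) :
    (noiseLaw σw).real A * variance (xi a w i) (cond P (futureNoise w 0 ⁻¹' A)) =
      ∫ v in A, noiseXi a i v ^ 2 ∂noiseLaw σw := by
  have hS := hloop.measurable_future 0
  have hxi : xi a w i = fun ω => noiseXi a i (futureNoise w 0 ω) :=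
    funext fun ω => (noiseXi_futureNoise_zero w i ω).symm
  have htransfer : ∀ f : (ℕ → ℝ) → ℝ, Measurable f →
      ∫ ω in futureNoise w 0 ⁻¹' A, f (futureNoise w 0 ω) ∂P = ∫ v in A, f v ∂noiseLaw σw := by
    intro f hf
    rw [← hloop.map_future 0, setIntegral_map hA hf.aestronglyMeasurable hS.aemeasurable]
  have hPA : (noiseLaw σw).real A = P.real (futureNoise w 0 ⁻¹' A) := by
    rw [measureReal_def, measureReal_def, ← hloop.map_future 0, Measure.map_apply hS hA]
  have hm : Measurable fun ω => noiseXi a i (futureNoise w 0 ω) := (measurable_noiseXi i).comp hS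
  rw [hPA, hxi, measureReal_mul_variance_cond hm]
  · exact htransfer _ ((measurable_noiseXi i).pow_const 2)
  · exact (htransfer _ (measurable_noiseXi i)).trans (setIntegral_noiseXi_eq_zero i hA hsymm)

lemma survival_mul_truncVar (i : ℕ) :
    (noiseLaw σw).real (noiseF a ε (i + 1)) * truncVar P a ε w i =
      ∫ v in noiseF a ε (i + 1), noiseXi a i v ^ 2 ∂noiseLaw σw := by
  rw [truncVar, ← preimage_noiseF,
    hloop.measureReal_mul_variance_xi i (measurableSet_noiseF _) (neg_mem_noiseF _)]

omit hloop in
/-- The noise sequences for which the transmission following the one at time `0` occurs at time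
`i + 1`. -/
def resetSet (a ε : ℝ) (T i : ℕ) : Set (ℕ → ℝ) :=
  if i < T then noiseF a ε i \ noiseF a ε (i + 1) else noiseF a ε i

/-- For i < T, p_{i0} q_i = q_i - q_{i+1} is the probability of `resetSet`. At i = T the reset is
certain and the second moment comes from the recursion ξ_T = a ξ_{T-1} + w_T. -/
lemma resetProb_mul_truncVarC (hσ : 0 < σw) (hε : 0 < ε) {i : ℕ} (hi : i ≤ T) :
    resetProb P a ε T w i * (noiseLaw σw).real (noiseF a ε i) * truncVarC P a ε T σw w i =
      ∫ v in resetSet a ε T i, noiseXi a i v ^ 2 ∂noiseLaw σw := by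
  rcases hi.lt_or_eq with hlt | rfl
  · rw [truncVarC, resetSet, if_pos hlt, if_pos hlt, hloop.resetProb_of_lt hlt,
      ← hloop.measureReal_mul_variance_xi i
        ((measurableSet_noiseF i).diff (measurableSet_noiseF _))
        fun v => by simp only [Set.mem_sdiff, neg_mem_noiseF],
      measureReal_sdiff (noiseF_succ_subset i) (measurableSet_noiseF _), noiseF_diff,
      Set.preimage_inter, preimage_noiseF]
    have hpos : (noiseLaw σw).real (noiseF a ε i) ≠ 0 :=
      ENNReal.toReal_ne_zero.2 ⟨(noiseLaw_noiseF_pos hσ hε i).ne', measure_ne_top _ _⟩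
    have hset : futureNoise w 0 ⁻¹' {v | ε < |noiseXi a i v|} = {ω | ε < |xi a w i ω|} := by
      ext ω
      simp [noiseXi_futureNoise_zero]
    rw [hset, sub_mul, div_mul_cancel₀ _ hpos, one_mul]
  · rw [truncVarC, resetSet, if_neg (lt_irrefl _), if_neg (lt_irrefl _), resetProb,
      if_neg (lt_irrefl _), one_mul]
    cases i with
    | zero =>
      simp [noiseF_zero, noiseXi_zero, integral_eval_sq_noiseLaw]
    | succ n =>
      rw [setIntegral_noiseXi_succ_sq, ← hloop.survival_mul_truncVar, if_neg (by omega),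
        Nat.add_sub_cancel]
      ring

omit hloop [IsProbabilityMeasure P] in
lemma setIntegral_noiseF_of_lt {i : ℕ} (hi : i < T) :
    ∫ v in noiseF a ε i, noiseXi a i v ^ 2 ∂noiseLaw σw =
      ∫ v in noiseF a ε (i + 1), noiseXi a i v ^ 2 ∂noiseLaw σw +
        ∫ v in resetSet a ε T i, noiseXi a i v ^ 2 ∂noiseLaw σw := by
  have hint : Integrable (fun v => noiseXi a i v ^ 2) (noiseLaw σw) :=
    (memLp_noiseXi i (by simp)).integrable_sq
  rw [resetSet, if_pos hi, add_comm, ← setIntegral_union Set.disjoint_sdiff_left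
    (measurableSet_noiseF _) hint.integrableOn hint.integrableOn,
    Set.sdiff_union_of_subset (noiseF_succ_subset i)]

lemma hasAverage_reset_indicator {i : ℕ} {φ : (ℕ → ℝ) → ℝ}
    (hφ : Measurable φ) (hφ2 : MemLp φ 2 (noiseLaw σw))
    (hdep : ∀ v v', (∀ k < i + 1, v k = v' k) → φ v = φ v') :
    ∀ᵐ ω ∂P, HasAverage (fun m =>
      (if r m ω = 0 then (noiseF a ε i).indicator φ (futureNoise w m ω) else 0) +
        -(∫ v in noiseF a ε i, φ v ∂noiseLaw σw) * (if r m ω = 0 then 1 else 0)) 0 := by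
  have hF := measurableSet_noiseF (a := a) (ε := ε) i
  have h := hloop.ae_tendsto_average_reset (d := i + 1) (hφ.indicator hF) (hφ2.indicator hF)
    fun v v' h => indicator_noiseF_congr (fun k hk => h k (by omega)) (hdep v v' h)
  filter_upwards [h] with ω hω
  rw [integral_indicator hF] at hω
  refine HasAverage.congr hω fun m => ?_
  split_ifs <;> ring

/-- The asymptotic frequency of transmissions. -/
lemma hasAverage_reset (hb : b ≠ 0) (hK : K = -a / b) (hσ : 0 < σw) (hε : 0 < ε) :
    ∀ᵐ ω ∂P, HasAverage (fun m => if r m ω = 0 then 1 else 0)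
      (1 / ∑ i ∈ Finset.range (T + 1), (noiseLaw σw).real (noiseF a ε i)) := by
  have h := fun i => hloop.hasAverage_reset_indicator (i := i) (φ := fun _ => 1) measurable_const
    (memLp_const 1) fun _ _ _ => rfl
  filter_upwards [ae_all_iff.2 h] with ω hω
  set q : ℕ → ℝ := fun i => (noiseLaw σw).real (noiseF a ε i) with hq
  set e : ℕ → ℝ := fun m => if r m ω = 0 then 1 else 0 with he
  have hqpos : 0 < ∑ i ∈ Finset.range (T + 1), q i :=
    Finset.sum_pos (fun i _ => ENNReal.toReal_pos (noiseLaw_noiseF_pos hσ hε i).ne'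
      (measure_ne_top _ _)) (by simp)
  have he1 : ∀ n, |e n| ≤ 1 := fun n => by
    simp only [he]
    split_ifs <;> simp
  -- The i-th sequence is shifted by T + 1 - i so that all terms refer to the counter at time n + T
  -- + 1, where the indicators sum to 1. Replacing each shifted `e` by `e n` costs nothing on
  -- average, which leaves 1 - (∑ q_i) e n with average 0.
  have h1 : HasAverage (fun n => ∑ i ∈ Finset.range (T + 1),
      (((if r (n + (T + 1 - i)) ω = 0 then (noiseF a ε i).indicator (fun _ => (1 : ℝ))
        (futureNoise w (n + (T + 1 - i)) ω) else 0) + -q i * e (n + (T + 1 - i))) +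
        q i * (e (n + (T + 1 - i)) - e n))) (∑ i ∈ Finset.range (T + 1), (0 + q i * 0)) := by
    refine HasAverage.sum fun i _ => HasAverage.add ?_
      ((hasAverage_sub_shift he1 (T + 1 - i)).const_mul (q i))
    have := (hasAverage_add_iff (T + 1 - i)).2 (hω i)
    simp only [setIntegral_const, smul_eq_mul, mul_one] at this
    exact this
  have h2 : ∀ n, ∑ i ∈ Finset.range (T + 1),
      (((if r (n + (T + 1 - i)) ω = 0 then (noiseF a ε i).indicator (fun _ => (1 : ℝ))
        (futureNoise w (n + (T + 1 - i)) ω) else 0) + -q i * e (n + (T + 1 - i))) +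
        q i * (e (n + (T + 1 - i)) - e n)) =
      1 + -(∑ i ∈ Finset.range (T + 1), q i) * e n := by
    intro n
    have := hloop.sum_reset_indicator hb hK (fun _ _ => 1) 1 ω (k := n + (T + 1)) (by omega)
      fun _ _ _ _ => rfl
    refine Eq.trans ?_ (congrArg (· + -(∑ i ∈ Finset.range (T + 1), q i) * e n) this)
    rw [neg_mul, Finset.sum_mul, ← sub_eq_add_neg, ← Finset.sum_sub_distrib]
    refine Finset.sum_congr rfl fun i hi => ?_
    have hi' := Finset.mem_range.1 hi
    rw [show n + (T + 1 - i) = n + (T + 1) - i by omega]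
    ring
  have h3 := h1.congr h2
  simp only [mul_zero, add_zero, Finset.sum_const_zero] at h3
  have h4 := ((hasAverage_const 1).add (h3.const_mul (-1))).const_mul
    (1 / ∑ i ∈ Finset.range (T + 1), q i)
  rw [mul_zero, add_zero, mul_one] at h4
  refine h4.congr fun n => ?_
  field_simp
  ring

omit hloop in
/-- The cost at time `i + 1` when the latest transmission took place at time `0`. -/
noncomputable def stageCost (a ε : ℝ) (T : ℕ) (Q κ : ℝ) (i : ℕ) (v : ℕ → ℝ) : ℝ :=
  Q * noiseXi a i v ^ 2 + κ * {v | ε < |noiseXi a i v| ∨ T ≤ i}.indicator (noiseXi a i · ^ 2) v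

section StageCost

variable {Q κ : ℝ}

omit hloop [IsProbabilityMeasure P]

lemma measurableSet_threshold (i : ℕ) :
    MeasurableSet {v : ℕ → ℝ | ε < |noiseXi a i v| ∨ T ≤ i} :=
  (measurableSet_lt measurable_const (measurable_noiseXi i).abs).union (MeasurableSet.const _)

lemma measurable_stageCost (i : ℕ) : Measurable (stageCost a ε T Q κ i) :=
  (((measurable_noiseXi i).pow_const 2).const_mul Q).add
    ((((measurable_noiseXi i).pow_const 2).indicator (measurableSet_threshold i)).const_mul κ)

/-- The strong law needs a square-integrable cost, hence the fourth moment of ξ_i. -/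
lemma memLp_noiseXi_sq (i : ℕ) : MemLp (fun v => noiseXi a i v ^ 2) 2 (noiseLaw σw) := by
  rw [memLp_two_iff_integrable_sq ((measurable_noiseXi i).pow_const 2).aestronglyMeasurable]
  have h := (memLp_noiseXi (a := a) (σ := σw) i (p := (4 : ℕ)) (by simp)).integrable_norm_pow'
  refine h.congr (ae_of_all _ fun v => ?_)
  simp only [Real.norm_eq_abs]
  rw [← pow_mul, show 2 * 2 = 4 from rfl]
  exact Even.pow_abs ⟨2, rfl⟩ _

lemma memLp_stageCost (i : ℕ) : MemLp (stageCost a ε T Q κ i) 2 (noiseLaw σw) :=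
  ((memLp_noiseXi_sq i).const_mul Q).add
    (((memLp_noiseXi_sq i).indicator (measurableSet_threshold i)).const_mul κ)

lemma stageCost_congr (i : ℕ) {v v' : ℕ → ℝ} (h : ∀ k < i + 1, v k = v' k) :
    stageCost a ε T Q κ i v = stageCost a ε T Q κ i v' := by
  simp only [stageCost, Set.indicator, Set.mem_ofPred_eq, noiseXi_congr i h]

lemma setIntegral_stageCost (i : ℕ) (hi : i ≤ T) :
    ∫ v in noiseF a ε i, stageCost a ε T Q κ i v ∂noiseLaw σw =
      Q * ∫ v in noiseF a ε i, noiseXi a i v ^ 2 ∂noiseLaw σw +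
        κ * ∫ v in resetSet a ε T i, noiseXi a i v ^ 2 ∂noiseLaw σw := by
  have hint : Integrable (fun v => noiseXi a i v ^ 2) (noiseLaw σw) :=
    (memLp_noiseXi i (by simp)).integrable_sq
  have hB := measurableSet_threshold (a := a) (ε := ε) (T := T) i
  have hset : noiseF a ε i ∩ {v | ε < |noiseXi a i v| ∨ T ≤ i} = resetSet a ε T i := by
    rcases hi.lt_or_eq with hlt | rfl
    · rw [resetSet, if_pos hlt, noiseF_diff, Set.inter_comm]
      simp [not_le.2 hlt]
    · simp [resetSet]
  simp only [stageCost]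
  rw [integral_add (hint.const_mul Q).integrableOn
    ((hint.indicator hB).const_mul κ).integrableOn, integral_const_mul, integral_const_mul,
    setIntegral_indicator hB, hset]

end StageCost

omit [IsProbabilityMeasure P] in
-- The input at time m + i + 1 acts only if the counter returns to 0 there, by threshold or
-- time-out; this is the indicator in `stageCost`.
lemma cost_eq_stageCost (hb : b ≠ 0) (hK : K = -a / b) {Qx Qu ρ : ℝ} {m i : ℕ} {ω : Ω}
    (hi : i ≤ T) (h : r (m + i) ω = i) :
    Qx * x (m + i + 1) ω ^ 2 + ρ * (Qu * u (m + i + 1) ω ^ 2) =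
      stageCost a ε T Qx (ρ * (K * Qu * K)) i (futureNoise w m ω) := by
  have hx := hloop.state_of_counter_add hb hK hi h
  rw [hloop.input, hloop.counter, h, stageCost, hx]
  by_cases hcond : ε < |noiseXi a i (futureNoise w m ω)| ∨ T ≤ i
  · rw [Set.indicator_of_mem (by exact hcond), if_pos hcond, if_pos rfl]
    ring
  · rw [Set.indicator_of_notMem (by exact hcond), if_neg hcond, if_neg (by omega)]
    ring

lemma sum_setIntegral_stageCost (hσ : 0 < σw) (hε : 0 < ε) (Q κ : ℝ) :
    ∑ i ∈ Finset.range (T + 1), ∫ v in noiseF a ε i, stageCost a ε T Q κ i v ∂noiseLaw σw =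
      resetProb P a ε T w 0 * (Q + κ) * truncVarC P a ε T σw w 0 +
        ∑ i ∈ Finset.Icc 1 T,
          (Q * truncVar P a ε w (i - 1) +
            resetProb P a ε T w i * (Q + κ) * truncVarC P a ε T σw w i) *
          ∏ j ∈ Finset.range i, (1 - resetProb P a ε T w j) := by
  set q : ℕ → ℝ := fun i => (noiseLaw σw).real (noiseF a ε i) with hq
  -- The second moment of ξ_i on F_i splits into `A i`, without a transmission, and `B i`, with one;
  -- for i = T only `B T` remains.
  set A : ℕ → ℝ := fun i => ∫ v in noiseF a ε (i + 1), noiseXi a i v ^ 2 ∂noiseLaw σw with hA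
  set B : ℕ → ℝ := fun i => ∫ v in resetSet a ε T i, noiseXi a i v ^ 2 ∂noiseLaw σw with hB
  have hq0 : q 0 = 1 := by simp [hq, noiseF_zero]
  have hqpos : ∀ i, 0 < q i := fun i =>
    ENNReal.toReal_pos (noiseLaw_noiseF_pos hσ hε i).ne' (measure_ne_top _ _)
  have hprod := prod_one_sub_resetProb hq0 hqpos fun i hi => hloop.resetProb_of_lt hi
  have hBi : ∀ i ≤ T, resetProb P a ε T w i * q i * truncVarC P a ε T σw w i = B i :=
    fun i hi => hloop.resetProb_mul_truncVarC hσ hε hi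
  have hAi : ∀ i, q (i + 1) * truncVar P a ε w i = A i := hloop.survival_mul_truncVar
  have hright : ∑ i ∈ Finset.Icc 1 T,
      (Q * truncVar P a ε w (i - 1) +
        resetProb P a ε T w i * (Q + κ) * truncVarC P a ε T σw w i) *
          ∏ j ∈ Finset.range i, (1 - resetProb P a ε T w j) =
      ∑ i ∈ Finset.range T, (Q * A i + (Q + κ) * B (i + 1)) := by
    rw [← Finset.Ico_add_one_right_eq_Icc, Finset.sum_Ico_eq_sum_range, Nat.add_sub_cancel]
    refine Finset.sum_congr rfl fun i hi => ?_
    have hi' := Finset.mem_range.1 hi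
    rw [add_comm 1 i, hprod _ (by omega), Nat.add_sub_cancel, ← hAi, ← hBi _ (by omega)]
    ring
  have hleft : ∀ i ∈ Finset.range T,
      ∫ v in noiseF a ε i, stageCost a ε T Q κ i v ∂noiseLaw σw =
        Q * A i + (Q + κ) * B i := by
    intro i hi
    have hi' := Finset.mem_range.1 hi
    rw [setIntegral_stageCost i hi'.le, setIntegral_noiseF_of_lt hi']
    ring
  have hlast : ∫ v in noiseF a ε T, stageCost a ε T Q κ T v ∂noiseLaw σw = (Q + κ) * B T := by
    rw [setIntegral_stageCost T le_rfl]
    simp only [hB, resetSet, lt_irrefl, if_false]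
    ring
  have h0 := hBi 0 (Nat.zero_le T)
  rw [hq0, mul_one] at h0
  rw [hright, Finset.sum_range_succ, Finset.sum_congr rfl hleft, hlast, Finset.sum_add_distrib,
    Finset.sum_add_distrib, ← Finset.mul_sum _ _ (Q + κ), ← Finset.mul_sum _ _ (Q + κ)]
  -- The integrals pair `A i` with `B i`, while the target formula pairs `A i` with `B (i + 1)`.
  have htel : ∑ i ∈ Finset.range T, B i + B T = ∑ i ∈ Finset.range T, B (i + 1) + B 0 := by
    rw [← Finset.sum_range_succ, Finset.sum_range_succ']
  rw [mul_right_comm, h0]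
  linear_combination (Q + κ) * htel

theorem hasAverage_cost (hb : b ≠ 0) (hK : K = -a / b) (hσ : 0 < σw) (hε : 0 < ε)
    (Qx Qu ρ : ℝ) :
    ∀ᵐ ω ∂P, HasAverage (fun k => Qx * x k ω ^ 2 + ρ * (Qu * u k ω ^ 2))
      ((∑ i ∈ Finset.range (T + 1),
        ∫ v in noiseF a ε i, stageCost a ε T Qx (ρ * (K * Qu * K)) i v ∂noiseLaw σw) *
        (1 / ∑ i ∈ Finset.range (T + 1), (noiseLaw σw).real (noiseF a ε i))) := by
  set κ := ρ * (K * Qu * K) with hκ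
  have h := fun i => hloop.hasAverage_reset_indicator (i := i) (φ := stageCost a ε T Qx κ i)
    (measurable_stageCost i) (memLp_stageCost i) fun v v' h => stageCost_congr i h
  filter_upwards [ae_all_iff.2 h, hloop.hasAverage_reset hb hK hσ hε] with ω hω hreset
  have h1 : ∀ i, HasAverage (fun m =>
      if r m ω = 0 then (noiseF a ε i).indicator (stageCost a ε T Qx κ i) (futureNoise w m ω)
      else 0) ((∫ v in noiseF a ε i, stageCost a ε T Qx κ i v ∂noiseLaw σw) *
        (1 / ∑ i ∈ Finset.range (T + 1), (noiseLaw σw).real (noiseF a ε i))) := by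
    intro i
    have := (hω i).add
      (hreset.const_mul (∫ v in noiseF a ε i, stageCost a ε T Qx κ i v ∂noiseLaw σw))
    rw [zero_add] at this
    exact this.congr fun m => by ring
  -- The decomposition at time k = n + T + 1 > T describes the cost at k + 1, hence the shift T + 2
  -- for the cost against T + 1 - i for the terms.
  rw [Finset.sum_mul, ← hasAverage_add_iff (T + 2)]
  refine HasAverage.congr (HasAverage.sum fun i _ => (hasAverage_add_iff (T + 1 - i)).2 (h1 i))
    fun n => ?_
  rw [← hloop.sum_reset_indicator hb hK (stageCost a ε T Qx κ)
    (Qx * x (n + (T + 2)) ω ^ 2 + ρ * (Qu * u (n + (T + 2)) ω ^ 2)) ω (k := n + (T + 1)) (by omega)]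
  · refine Finset.sum_congr rfl fun i hi => ?_
    have := Finset.mem_range.1 hi
    rw [show n + (T + 1 - i) = n + (T + 1) - i by omega]
  · intro m i hmi hr
    have hiT : i ≤ T := hr ▸ hloop.counter_succ_le (n + T) ω
    rw [show n + (T + 2) = m + i + 1 by omega]
    rw [← hmi] at hr
    exact (hloop.cost_eq_stageCost hb hK hiT hr).symm

end ClosedLoop

end EventTriggered

theorem theorem2 {Ω : Type*} [MeasurableSpace Ω] (P : Measure Ω) [IsProbabilityMeasure P]
    (a b K ε : ℝ) (T : ℕ) (σw σ0 : ℝ≥0) (Qx Qu ρ : ℝ)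
    (x u w : ℕ → Ω → ℝ) (r : ℕ → Ω → ℕ)
    (hb : b ≠ 0) (hK : K = -a / b) (hε : 0 < ε) (hσw : 0 < σw) (hQx : 0 ≤ Qx) (hQu : 0 < Qu)
    (hloop : EventTriggered.ClosedLoop P a b K ε T σw σ0 x u w r) :
    -- `p_{ij}` is the transition probability of the counter `r_k` from `i` to `j`
    -- (homogeneous once the influence of the initial state has died out)
    (∀ k, T < k → ∀ i j : Fin (T + 1),
      P {ω | r k ω = i} ≠ 0 ∧
      (cond P {ω | r k ω = i}).real {ω | r (k + 1) ω = j} =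
        EventTriggered.transMatrix P a ε T w i j) ∧
    -- `π` is its unique invariant distribution, and the long-run average cost is as claimed
    ∃ π : Fin (T + 1) → ℝ,
      (∀ i, 0 < π i) ∧
      (∀ μ : Fin (T + 1) → ℝ,
        (μ ∈ stdSimplex ℝ (Fin (T + 1)) ∧ μ ᵥ* EventTriggered.transMatrix P a ε T w = μ) ↔
          μ = π) ∧
      ∀ᵐ ω ∂P, Tendsto
        (fun N : ℕ => (1 / (N : ℝ)) *
          ∑ k ∈ Finset.range N, (Qx * x k ω ^ 2 + ρ * (Qu * u k ω ^ 2)))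
        atTop
        (𝓝 ((EventTriggered.resetProb P a ε T w 0 * (Qx + ρ * (K * Qu * K)) *
              EventTriggered.truncVarC P a ε T σw w 0 +
            ∑ i ∈ Finset.Icc 1 T,
              (Qx * EventTriggered.truncVar P a ε w (i - 1) +
                EventTriggered.resetProb P a ε T w i * (Qx + ρ * (K * Qu * K)) *
                  EventTriggered.truncVarC P a ε T σw w i) *
              ∏ j ∈ Finset.range i, (1 - EventTriggered.resetProb P a ε T w j)) * π 0)) := by
  refine ⟨fun k hk i j => hloop.transition_probability hb hK hσw hε hk i j, ?_⟩
  set q : ℕ → ℝ := fun i =>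
    (EventTriggered.noiseLaw σw).real (EventTriggered.noiseF a ε i) with hq
  have hq0 : q 0 = 1 := by simp [hq, EventTriggered.noiseF_zero]
  have hqpos : ∀ i, 0 < q i := fun i =>
    ENNReal.toReal_pos (EventTriggered.noiseLaw_noiseF_pos hσw hε i).ne' (measure_ne_top _ _)
  have hQpos : 0 < ∑ j ∈ Finset.range (T + 1), q j :=
    Finset.sum_pos (fun i _ => hqpos i) (by simp)
  -- Normalised survival probabilities; as q 0 = 1, the value at 0 is the transmission frequency.
  refine ⟨fun i => q i / ∑ j ∈ Finset.range (T + 1), q j, fun i => div_pos (hqpos i) hQpos,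
    EventTriggered.invariant_iff_eq_survival hq0 hqpos (fun i hi => hloop.resetProb_of_lt hi)
      (by simp [EventTriggered.resetProb]) fun i j => rfl, ?_⟩
  filter_upwards [hloop.hasAverage_cost hb hK hσw hε Qx Qu ρ] with ω hω
  rw [hloop.sum_setIntegral_stageCost hσw hε] at hω
  simp only [Fin.val_zero, hq0]
  exact hω
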